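/- For $f\in L^1_{loc}(\mathbb R)$ let $$\widetilde M f(x)=\sup_{I\ni x}\frac1{|I|}\int_I |f(y)|\,dy ,\qquad x\in\mathbb R,$$ be the one-dimensional uncentered Hardy–Littlewood maximal function, where the supremum runs over all bounded open intervals $I$ containing $x$. Let $W^{1,1}(\mathbb R)$ be the space of real-valued $f\in L^1(\mathbb R)$ with weak derivative $f'\in L^1(\mathbb R)$, with the norm $\|f\|_{W^{1,1}}=\|f\|_{L^1}+\|f'\|_{L^1}$. Then for every $f\in W^{1,1}(\mathbb R)$ the function $\widetilde M f$ is finite everywhere and has a weak derivative $(\widetilde M f)'\in L^1(\mathbb R)$, and the map $f\mapsto(\widetilde M f)'$ is continuous from $W^{1,1}(\mathbb R)$ to $L^1(\mathbb R)$: if $\|f_j-f\|_{W^{1,1}}\to0$, then $\|(\widetilde M f_j)'-(\widetilde M f)'\|_{L^1}\to 0$. -/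

import Mathlib

open MeasureTheory
open scoped ENNReal ContDiff

/-- `v` is a weak (distributional) derivative of `u` on the real line: both functions are locally
integrable, and `∫ u φ' = - ∫ v φ` for every test function `φ ∈ C_c^∞(ℝ)`. -/
structure HasWeakDeriv (u v : ℝ → ℝ) : Prop where
  locallyIntegrable : LocallyIntegrable u volume
  locallyIntegrable_deriv : LocallyIntegrable v volume
  integral_eq : ∀ φ : ℝ → ℝ, ContDiff ℝ ∞ φ → HasCompactSupport φ →
    ∫ x, u x * deriv φ x = - ∫ x, v x * φ x

theorem integrable_mul_test {u φ : ℝ → ℝ} (hu : LocallyIntegrable u volume)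
    (hφ : Continuous φ) (hc : HasCompactSupport φ) :
    Integrable (fun x => u x * φ x) volume := by
  have h := hu.integrable_smul_left_of_hasCompactSupport hφ hc
  simpa [mul_comm] using h

theorem HasWeakDeriv.congr_ae {u v u' v' : ℝ → ℝ} (h : HasWeakDeriv u v)
    (hu : u =ᵐ[volume] u') (hv : v =ᵐ[volume] v') : HasWeakDeriv u' v' where
  locallyIntegrable := h.locallyIntegrable.congr hu
  locallyIntegrable_deriv := h.locallyIntegrable_deriv.congr hv
  integral_eq φ hφ hc := by
    have h1 : ∫ x, u x * deriv φ x = ∫ x, u' x * deriv φ x :=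
      integral_congr_ae (hu.mono fun x hx => by simp only [hx])
    have h2 : ∫ x, v x * φ x = ∫ x, v' x * φ x :=
      integral_congr_ae (hv.mono fun x hx => by simp only [hx])
    rw [← h1, ← h2]
    exact h.integral_eq φ hφ hc

theorem HasWeakDeriv.zero : HasWeakDeriv (fun _ => 0) (fun _ => 0) where
  locallyIntegrable := locallyIntegrable_const 0
  locallyIntegrable_deriv := locallyIntegrable_const 0
  integral_eq φ _ _ := by simp

theorem HasWeakDeriv.add {u v u' v' : ℝ → ℝ} (h : HasWeakDeriv u v) (h' : HasWeakDeriv u' v') :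
    HasWeakDeriv (fun x => u x + u' x) (fun x => v x + v' x) where
  locallyIntegrable := h.locallyIntegrable.add h'.locallyIntegrable
  locallyIntegrable_deriv := h.locallyIntegrable_deriv.add h'.locallyIntegrable_deriv
  integral_eq φ hφ hc := by
    have hd : Continuous (deriv φ) := hφ.continuous_deriv (by simp)
    simp only [add_mul]
    rw [integral_add (integrable_mul_test h.locallyIntegrable hd hc.deriv)
        (integrable_mul_test h'.locallyIntegrable hd hc.deriv),
      integral_add (integrable_mul_test h.locallyIntegrable_deriv hφ.continuous hc)
        (integrable_mul_test h'.locallyIntegrable_deriv hφ.continuous hc),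
      h.integral_eq φ hφ hc, h'.integral_eq φ hφ hc, neg_add]

theorem HasWeakDeriv.const_mul {u v : ℝ → ℝ} (c : ℝ) (h : HasWeakDeriv u v) :
    HasWeakDeriv (fun x => c * u x) (fun x => c * v x) where
  locallyIntegrable := h.locallyIntegrable.smul c
  locallyIntegrable_deriv := h.locallyIntegrable_deriv.smul c
  integral_eq φ hφ hc := by
    simp only [mul_assoc, integral_const_mul]
    rw [h.integral_eq φ hφ hc, mul_neg]

/-- The Sobolev space `W^{1,1}(ℝ)` of real-valued functions, as the space of pairs `(f, f')` with
`f ∈ L¹(ℝ)` and `f' ∈ L¹(ℝ)` the weak derivative of `f`. It carries the norm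
`‖f‖_{L¹} + ‖f'‖_{L¹}` (see `SobolevW11.norm_eq`). -/
def SobolevW11 : Submodule ℝ
    (WithLp 1 (Lp ℝ 1 (volume : Measure ℝ) × Lp ℝ 1 (volume : Measure ℝ))) where
  carrier := {p | HasWeakDeriv p.fst p.snd}
  zero_mem' := HasWeakDeriv.zero.congr_ae (Lp.coeFn_zero ℝ 1 volume).symm
    (Lp.coeFn_zero ℝ 1 volume).symm
  add_mem' {p q} hp hq := (HasWeakDeriv.add hp hq).congr_ae (Lp.coeFn_add p.fst q.fst).symm
    (Lp.coeFn_add p.snd q.snd).symm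
  smul_mem' c p hp := (HasWeakDeriv.const_mul c hp).congr_ae (Lp.coeFn_smul c p.fst).symm
    (Lp.coeFn_smul c p.snd).symm

/-- The function `f ∈ L¹(ℝ)` underlying an element of `W^{1,1}(ℝ)`. -/
def SobolevW11.toL1 (f : SobolevW11) : Lp ℝ 1 (volume : Measure ℝ) := f.1.fst

/-- The weak derivative `f' ∈ L¹(ℝ)` of an element `f` of `W^{1,1}(ℝ)`. -/
def SobolevW11.weakDeriv (f : SobolevW11) : Lp ℝ 1 (volume : Measure ℝ) := f.1.snd

theorem SobolevW11.norm_eq (f : SobolevW11) : ‖f‖ = ‖toL1 f‖ + ‖weakDeriv f‖ := by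
  rw [Submodule.coe_norm, WithLp.prod_norm_eq_add (by norm_num)]
  simp [toL1, weakDeriv]

/-- The one-dimensional uncentered Hardy–Littlewood maximal function, with values in `[0, ∞]`:
the supremum of the averages of `|f|` over all open balls (of positive radius) containing `x`. -/
noncomputable def uncenteredMaximal (f : ℝ → ℝ) (x : ℝ) : ℝ≥0∞ :=
  ⨆ (c : ℝ) (r : ℝ) (_ : x ∈ Metric.ball c r), ⨍⁻ y in Metric.ball c r, ‖f y‖ₑ ∂volume

/-!
The average of `p = |f|` over an interval containing `x` is a convex combination of its averages
over `[a, x]` and `[x, b]`, so the uncentered maximal function is the maximum of the two one-sided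
maximal functions of `p` (`IsNonnegW11.uncenteredMaximal_eq`). The left one is the reflection of
the right one, so everything reduces to the right-sided maximal function `g = rightMax p`.

*Structure of `g`.* Where `g` is differentiable and `[x, x + h]` is a maximizing interval,
`g' x = (g x - p x) / h ≥ 0` if `h > 0`, while `g' x = p' x` if `g x = p x`
(`deriv_rightMax_of_pos`, `deriv_rightMax_of_eq`). Hence `g' ≥ -|p'|`. Together with the local
Lipschitz continuity of `g` on `{g > p}` this makes `g` absolutely continuous with integrable
derivative (`isACL1_rightMax`), and `∫ g' = 0` because `g` vanishes at `±∞`.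

*Continuity.* Let `p_j → p` with `∑ ‖p_j' - p'‖₁ < ∞`, which can be arranged along subsequences.
The formula for the derivative and compactness of the set `[0, ∞]` of possible lengths `h` give
`g_j' → g'` almost everywhere; the delicate case of shrinking maximizing intervals is settled by a
first-order expansion of the `p_j` that is uniform in `j` (`ae_uniform_expansion`). As
`∫ g_j' = ∫ g' = 0`, one has `‖g_j' - g'‖₁ = 2 ∫ (g' - g_j')⁺`, and the integrand is at most
`|g'| + |p_j'|`, so dominated convergence applies (`tendsto_deriv_rightMax_of_summable`).

Both `f ↦ |f| = max f (-f)` and the passage from the two one-sided maximal functions to their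
maximum are handled by one lemma on maxima (`IsACL1.tendsto_deriv_max`).
-/

section
open Set Filter Topology
open scoped NNReal

/-! ### Absolutely continuous functions with integrable derivative -/

/-- `u : ℝ → ℝ` is absolutely continuous on every bounded interval and its (almost everywhere
defined) classical derivative is integrable on the whole line. -/
structure IsACL1 (u : ℝ → ℝ) : Prop where
  ac : ∀ a b, AbsolutelyContinuousOnInterval u a b
  integrable_deriv : Integrable (deriv u) volume

theorem ae_of_forall_ae_uIcc {P : ℝ → Prop} (h : ∀ a b : ℝ, ∀ᵐ x : ℝ, x ∈ uIcc a b → P x) :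
    ∀ᵐ x : ℝ, P x := by
  have : ∀ᵐ x : ℝ, ∀ n : ℕ, x ∈ uIcc (-(n : ℝ)) n → P x := ae_all_iff.2 fun n => h _ _
  filter_upwards [this] with x hx
  obtain ⟨n, hn⟩ := exists_nat_ge |x|
  refine hx n ?_
  rw [uIcc_of_le (by linarith [abs_nonneg x])]
  exact abs_le.1 hn

theorem AbsolutelyContinuousOnInterval.abs {u : ℝ → ℝ} {a b : ℝ}
    (h : AbsolutelyContinuousOnInterval u a b) :
    AbsolutelyContinuousOnInterval (fun x => |u x|) a b := by
  refine squeeze_zero (fun t => Finset.sum_nonneg fun i _ => dist_nonneg) (fun t => ?_) h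
  refine Finset.sum_le_sum fun i _ => ?_
  simpa [Real.dist_eq] using abs_abs_sub_abs_le_abs_sub (u (t.2 i).1) (u (t.2 i).2)

theorem AbsolutelyContinuousOnInterval.max {u v : ℝ → ℝ} {a b : ℝ}
    (hu : AbsolutelyContinuousOnInterval u a b) (hv : AbsolutelyContinuousOnInterval v a b) :
    AbsolutelyContinuousOnInterval (fun x => max (u x) (v x)) a b := by
  have h := ((hu.fun_add hv).fun_add (hu.fun_sub hv).abs).const_mul (2⁻¹ : ℝ)
  convert! h using 2 with x
  rcases le_total (u x) (v x) with hx | hx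
  · rw [max_eq_right hx, abs_of_nonpos (by linarith)]; ring
  · rw [max_eq_left hx, abs_of_nonneg (by linarith)]; ring

namespace IsACL1

variable {u v : ℝ → ℝ}

theorem continuous (h : IsACL1 u) : Continuous u := by
  rw [continuous_iff_continuousAt]
  intro x
  refine ((h.ac (x - 1) (x + 1)).continuousOn).continuousAt ?_
  rw [uIcc_of_le (by linarith)]
  exact Icc_mem_nhds (by linarith) (by linarith)

theorem ae_differentiableAt (h : IsACL1 u) : ∀ᵐ x, DifferentiableAt ℝ u x :=
  ae_of_forall_ae_uIcc fun a b => (h.ac a b).ae_differentiableAt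

theorem integral_deriv (h : IsACL1 u) (x y : ℝ) : ∫ t in x..y, deriv u t = u y - u x :=
  (h.ac x y).integral_deriv_eq_sub

theorem abs_sub_le_integral (h : IsACL1 u) (x y : ℝ) : |u y - u x| ≤ ∫ t, |deriv u t| := by
  rw [← h.integral_deriv]
  refine (intervalIntegral.norm_integral_le_integral_norm_uIoc (f := deriv u)
    (μ := volume)).trans ?_
  exact setIntegral_le_integral h.integrable_deriv.norm (ae_of_all _ fun _ => norm_nonneg _)

theorem neg (h : IsACL1 u) : IsACL1 (fun x => -u x) where
  ac a b := (h.ac a b).fun_neg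
  integrable_deriv := by
    have : deriv (fun x => -u x) = fun x => -deriv u x := by ext x; exact deriv.fun_neg
    rw [this]
    exact h.integrable_deriv.neg

theorem hasWeakDeriv (h : IsACL1 u) : HasWeakDeriv u (deriv u) where
  locallyIntegrable := h.continuous.locallyIntegrable
  locallyIntegrable_deriv := h.integrable_deriv.locallyIntegrable
  integral_eq φ hφ hc := by
    obtain ⟨R, hR⟩ := hc.isCompact.isBounded.subset_ball (0 : ℝ)
    have hR' : tsupport φ ⊆ Ioo (-R) R := by simpa [Real.ball_eq_Ioo] using hR
    have hout : ∀ x, x ∉ Ioo (-R) R → φ x = 0 := fun x hx =>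
      image_eq_zero_of_notMem_tsupport fun h => hx (hR' h)
    have h1 : ∫ x, u x * deriv φ x = ∫ x in (-R)..R, u x * deriv φ x := by
      refine (intervalIntegral.integral_eq_integral_of_support_subset fun x hx => ?_).symm
      have : x ∈ Function.support (deriv φ) := fun h0 => hx (by simp [h0])
      exact Ioo_subset_Ioc_self (hR' (support_deriv_subset this))
    have h2 : ∫ x, deriv u x * φ x = ∫ x in (-R)..R, deriv u x * φ x := by
      refine (intervalIntegral.integral_eq_integral_of_support_subset fun x hx => ?_).symm
      have : x ∈ Function.support φ := fun h0 => hx (by simp [h0])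
      exact Ioo_subset_Ioc_self (hR' (subset_tsupport _ this))
    have hφac : AbsolutelyContinuousOnInterval φ (-R) R :=
      (hφ.of_le (by simp)).contDiffOn.absolutelyContinuousOnInterval
    rw [h1, h2, (h.ac _ _).integral_mul_deriv_eq_deriv_mul hφac, hout R (by simp),
      hout (-R) (by simp)]
    simp

/-- Wherever `u`, `v` and `max u v` are all differentiable, the derivative of the maximum is the
derivative of each function attaining it; in particular `u' = v'` almost everywhere on
`{u = v}`. -/
theorem ae_deriv_max (hu : IsACL1 u) (hv : IsACL1 v) :
    ∀ᵐ x, (v x ≤ u x → deriv (fun y => max (u y) (v y)) x = deriv u x) ∧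
      (u x ≤ v x → deriv (fun y => max (u y) (v y)) x = deriv v x) := by
  have hm : ∀ᵐ x, DifferentiableAt ℝ (fun y => max (u y) (v y)) x :=
    ae_of_forall_ae_uIcc fun a b => ((hu.ac a b).max (hv.ac a b)).ae_differentiableAt
  have key : ∀ (w : ℝ → ℝ) (x : ℝ), DifferentiableAt ℝ (fun y => max (u y) (v y)) x →
      DifferentiableAt ℝ w x → (∀ y, w y ≤ max (u y) (v y)) → max (u x) (v x) = w x →
      deriv (fun y => max (u y) (v y)) x = deriv w x := by
    intro w x hmx hwx hle heq
    have hmin : IsLocalMin (fun y => max (u y) (v y) - w y) x :=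
      Eventually.of_forall fun y => by simpa [heq] using hle y
    have := hmin.deriv_eq_zero
    rw [deriv_fun_sub hmx hwx] at this
    linarith
  filter_upwards [hm, hu.ae_differentiableAt, hv.ae_differentiableAt] with x hx hux hvx
  exact ⟨fun hle => key u x hx hux (fun y => le_max_left _ _) (max_eq_left hle),
    fun hle => key v x hx hvx (fun y => le_max_right _ _) (max_eq_right hle)⟩

theorem max (hu : IsACL1 u) (hv : IsACL1 v) : IsACL1 (fun x => max (u x) (v x)) where
  ac a b := (hu.ac a b).max (hv.ac a b)
  integrable_deriv := by
    refine (hu.integrable_deriv.norm.add hv.integrable_deriv.norm).mono'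
      (measurable_deriv _).aestronglyMeasurable ?_
    filter_upwards [hu.ae_deriv_max hv] with x hx
    simp only [Pi.add_apply]
    rcases le_total (v x) (u x) with h | h
    · rw [hx.1 h]; linarith [norm_nonneg (deriv v x)]
    · rw [hx.2 h]; linarith [norm_nonneg (deriv u x)]

theorem integrable_deriv_sub (hu : IsACL1 u) (hv : IsACL1 v) :
    Integrable (fun x => |deriv u x - deriv v x|) :=
  (hu.integrable_deriv.sub hv.integrable_deriv).norm

/-- The map `(u, v) ↦ (max u v)'` is continuous for pointwise convergence of the functions together
with `L¹` convergence of the derivatives. -/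
theorem tendsto_deriv_max {U V : ℕ → ℝ → ℝ} (hU : ∀ j, IsACL1 (U j)) (hV : ∀ j, IsACL1 (V j))
    (hu : IsACL1 u) (hv : IsACL1 v)
    (hUu : ∀ x, Tendsto (fun j => U j x) atTop (𝓝 (u x)))
    (hVv : ∀ x, Tendsto (fun j => V j x) atTop (𝓝 (v x)))
    (hU' : Tendsto (fun j => ∫ x, |deriv (U j) x - deriv u x|) atTop (𝓝 0))
    (hV' : Tendsto (fun j => ∫ x, |deriv (V j) x - deriv v x|) atTop (𝓝 0)) :
    Tendsto (fun j => ∫ x, |deriv (fun y => Max.max (U j y) (V j y)) x -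
      deriv (fun y => Max.max (u y) (v y)) x|) atTop (𝓝 0) := by
  classical
  -- The derivative of the limit functions, selected by the comparison of the approximants.
  let k : ℕ → ℝ → ℝ := fun j x => if V j x ≤ U j x then deriv u x else deriv v x
  let m : ℝ → ℝ := fun x => deriv (fun y => Max.max (u y) (v y)) x
  have hkm : ∀ j, Measurable (k j) := fun j =>
    Measurable.ite (measurableSet_le (hV j).continuous.measurable (hU j).continuous.measurable)
      (measurable_deriv _) (measurable_deriv _)
  have hmint : Integrable m := (hu.max hv).integrable_deriv
  have hbound : ∀ j x, |k j x - m x| ≤ |deriv u x| + |deriv v x| + |m x| := by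
    intro j x
    refine (abs_sub _ _).trans ?_
    simp only [k]
    split_ifs <;> linarith [abs_nonneg (deriv u x), abs_nonneg (deriv v x)]
  have hdom : Integrable (fun x => |deriv u x| + |deriv v x| + |m x|) :=
    (hu.integrable_deriv.norm.add hv.integrable_deriv.norm).add hmint.norm
  have hlim : Tendsto (fun j => ∫ x, |k j x - m x|) atTop (𝓝 0) := by
    have := tendsto_integral_of_dominated_convergence (f := fun _ : ℝ => (0 : ℝ))
      (F := fun j x => |k j x - m x|) (μ := volume) _
      (fun j => ((hkm j).sub (measurable_deriv _)).norm.aestronglyMeasurable) hdom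
      (fun j => ae_of_all _ fun x => by simpa using hbound j x) ?_
    · simpa using this
    filter_upwards [hu.ae_deriv_max hv] with x hx
    refine tendsto_const_nhds.congr' ?_
    rcases lt_trichotomy (v x) (u x) with h | h | h
    · filter_upwards [(hVv x).eventually_lt (hUu x) h] with j hj
      simp [k, m, hj.le, hx.1 h.le]
    · refine Eventually.of_forall fun j => ?_
      have h1 := hx.1 h.le
      have h2 := hx.2 h.ge
      simp only [k, m]
      split_ifs <;> simp [h1, ← h2]
    · filter_upwards [(hUu x).eventually_lt (hVv x) h] with j hj
      simp [k, m, hj.not_ge, hx.2 h.le]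
  have hsum := (hU'.add hV').add hlim
  simp only [add_zero] at hsum
  refine squeeze_zero (fun j => integral_nonneg fun x => abs_nonneg _) (fun j => ?_) hsum
  have i1 := (hU j).integrable_deriv_sub hu
  have i2 := (hV j).integrable_deriv_sub hv
  have i3 : Integrable (fun x => |k j x - m x|) :=
    hdom.mono' ((hkm j).sub (measurable_deriv _)).norm.aestronglyMeasurable
      (ae_of_all _ fun x => by simpa using hbound j x)
  have i12 : Integrable (fun x => |deriv (U j) x - deriv u x| + |deriv (V j) x - deriv v x|) :=
    i1.add i2
  rw [← integral_add i1 i2, ← integral_add i12 i3]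
  refine integral_mono_ae (((hU j).max (hV j)).integrable_deriv_sub (hu.max hv))
    (i12.add i3) ?_
  filter_upwards [(hU j).ae_deriv_max (hV j)] with x hx
  have : |deriv (fun y => Max.max (U j y) (V j y)) x - k j x| ≤
      |deriv (U j) x - deriv u x| + |deriv (V j) x - deriv v x| := by
    simp only [k]
    split_ifs with h
    · rw [hx.1 h]; linarith [abs_nonneg (deriv (V j) x - deriv v x)]
    · rw [hx.2 (not_le.1 h).le]; linarith [abs_nonneg (deriv (U j) x - deriv u x)]
  have := _root_.abs_sub_le (deriv (fun y => Max.max (U j y) (V j y)) x) (k j x) (m x)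
  simp only [m] at *
  linarith

theorem tendsto_atTop_zero (h : IsACL1 u) (hi : Integrable u) : Tendsto u atTop (𝓝 0) := by
  have h1 : Tendsto u atTop (𝓝 (u 0 + ∫ t in Ioi 0, deriv u t)) := by
    refine (tendsto_const_nhds.add (intervalIntegral_tendsto_integral_Ioi (0 : ℝ)
      h.integrable_deriv.integrableOn tendsto_id)).congr fun x => ?_
    simp [h.integral_deriv]
  have h2 := IntegrableAtFilter.eq_zero_of_tendsto (hi.integrableAtFilter atTop) (fun s hs => by
    obtain ⟨b, hb⟩ := mem_atTop_sets.1 hs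
    exact top_le_iff.1 ((Real.volume_Ici (a := b)) ▸ measure_mono hb)) h1
  rwa [h2] at h1

theorem tendsto_atBot_zero (h : IsACL1 u) (hi : Integrable u) : Tendsto u atBot (𝓝 0) := by
  have h1 : Tendsto u atBot (𝓝 (u 0 - ∫ t in Iic 0, deriv u t)) := by
    refine (tendsto_const_nhds.sub (intervalIntegral_tendsto_integral_Iic (0 : ℝ)
      h.integrable_deriv.integrableOn tendsto_id)).congr fun x => ?_
    simp [h.integral_deriv]
  have h2 := IntegrableAtFilter.eq_zero_of_tendsto (hi.integrableAtFilter atBot) (fun s hs => by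
    obtain ⟨b, hb⟩ := mem_atBot_sets.1 hs
    exact top_le_iff.1 ((Real.volume_Iic (a := b)) ▸ measure_mono hb)) h1
  rwa [h2] at h1

end IsACL1

/-! ### The absolutely continuous representative of a `W^{1,1}` function -/

theorem isACL1_of_integral_eq_sub {u v : ℝ → ℝ} (hv : Integrable v)
    (h : ∀ x y, ∫ t in x..y, v t = u y - u x) : IsACL1 u ∧ deriv u =ᵐ[volume] v := by
  have hrep : ∀ a, u = fun x => u a + ∫ t in a..x, v t := fun a => by ext x; rw [h]; ring
  have hd : deriv u =ᵐ[volume] v := by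
    filter_upwards [LocallyIntegrable.ae_hasDerivAt_integral hv.locallyIntegrable] with x hx
    rw [hrep 0]
    exact ((hx 0).const_add _).deriv
  refine ⟨⟨fun a b => ?_, hv.congr hd.symm⟩, hd⟩
  rw [hrep a]
  refine AbsolutelyContinuousOnInterval.fun_add
    (LipschitzWith.const (α := ℝ) (u a)).lipschitzOnWith.absolutelyContinuousOnInterval ?_
  exact hv.intervalIntegrable.absolutelyContinuousOnInterval_intervalIntegral (by simp)

theorem isACL1_integral_Iic {v : ℝ → ℝ} (hv : Integrable v) :
    IsACL1 (fun x => ∫ t in Iic x, v t) ∧ deriv (fun x => ∫ t in Iic x, v t) =ᵐ[volume] v :=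
  isACL1_of_integral_eq_sub hv fun _ _ =>
    (intervalIntegral.integral_Iic_sub_Iic hv.integrableOn hv.integrableOn).symm

theorem IsACL1.comp_neg {u : ℝ → ℝ} (hu : IsACL1 u) : IsACL1 fun x => u (-x) := by
  refine (isACL1_of_integral_eq_sub (v := fun x => -deriv u (-x))
    hu.integrable_deriv.comp_neg.neg fun x y => ?_).1
  rw [intervalIntegral.integral_neg, intervalIntegral.integral_comp_neg (fun t => deriv u t),
    hu.integral_deriv]
  ring

/-- The du Bois-Reymond lemma: a function with vanishing weak derivative is almost everywhere
constant. -/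
theorem HasWeakDeriv.ae_eq_const {w : ℝ → ℝ} (h : HasWeakDeriv w (fun _ => 0)) :
    ∃ c : ℝ, w =ᵐ[volume] fun _ => c := by
  obtain ⟨ρ, hρc, hρ, hρ1⟩ : ∃ ρ : ℝ → ℝ, HasCompactSupport ρ ∧ ContDiff ℝ ∞ ρ ∧ ∫ x, ρ x = 1 := by
    let b : ContDiffBump (0 : ℝ) := ⟨1, 2, one_pos, one_lt_two⟩
    exact ⟨b.normed volume, b.hasCompactSupport_normed, b.contDiff_normed, b.integral_normed⟩
  have hint : ∀ {ψ : ℝ → ℝ}, ContDiff ℝ ∞ ψ → HasCompactSupport ψ →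
      Integrable (fun x => w x * ψ x) := fun hψ hc =>
    integrable_mul_test h.locallyIntegrable hψ.continuous hc
  refine ⟨∫ x, w x * ρ x, ?_⟩
  have hz : ∀ᵐ x, w x - ∫ x, w x * ρ x = 0 := by
    refine ae_eq_zero_of_integral_contDiff_smul_eq_zero
      (h.locallyIntegrable.sub (locallyIntegrable_const _)) fun ψ hψ hψc => ?_
    have hψi : Integrable ψ := hψ.continuous.integrable_of_hasCompactSupport hψc
    have hρi : Integrable ρ := hρ.continuous.integrable_of_hasCompactSupport hρc
    set I := ∫ x, ψ x
    -- `ψ - I ρ` has integral zero, so its primitive `φ` is again a test function.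
    let η : ℝ → ℝ := fun x => ψ x - I * ρ x
    have hη : ContDiff ℝ ∞ η := hψ.sub (contDiff_const.mul hρ)
    have hηc : HasCompactSupport η := hψc.sub hρc.mul_left
    have hηi : Integrable η := hψi.sub (hρi.const_mul I)
    have hη0 : ∫ x, η x = 0 := by
      simp only [η]
      rw [integral_sub hψi (hρi.const_mul I), integral_const_mul, hρ1]; simp [I]
    obtain ⟨R, hR⟩ := hηc.isCompact.isBounded.subset_ball (0 : ℝ)
    have hout : ∀ x, x ∉ Ioo (-R) R → η x = 0 := fun x hx =>
      image_eq_zero_of_notMem_tsupport fun h => hx (by simpa [Real.ball_eq_Ioo] using hR h)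
    let φ : ℝ → ℝ := fun x => ∫ t in (-R)..x, η t
    have hφd : ∀ x, HasDerivAt φ (η x) x := fun x =>
      (hη.continuous.integral_hasStrictDerivAt _ x).hasDerivAt
    have hφd' : deriv φ = η := funext fun x => (hφd x).deriv
    have hφ : ContDiff ℝ ∞ φ := by
      refine contDiff_infty_iff_deriv.2 ⟨fun x => (hφd x).differentiableAt, ?_⟩
      rwa [hφd']
    have hφc : HasCompactSupport φ := by
      refine HasCompactSupport.intro (isCompact_Icc (a := -R) (b := R)) fun x hx => ?_
      rcases lt_or_ge x (-R) with h1 | h1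
      · simp only [φ]
        rw [intervalIntegral.integral_symm, neg_eq_zero]
        refine intervalIntegral.integral_zero_ae (ae_of_all _ fun t ht => hout t fun ht' => ?_)
        rw [uIoc_of_le h1.le] at ht
        exact absurd ht.2 (not_le.2 ht'.1)
      · have h2 : R < x := by by_contra h2; exact hx ⟨h1, not_lt.1 h2⟩
        simp only [φ]
        rw [intervalIntegral.integral_eq_integral_of_support_subset, hη0]
        intro t ht
        have : t ∈ Ioo (-R) R := by by_contra h3; exact ht (hout t h3)
        exact ⟨this.1, (this.2.trans h2).le⟩
    have h0 := h.integral_eq φ hφ hφc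
    rw [hφd'] at h0
    have h1 : ∫ x, w x * η x = (∫ x, w x * ψ x) - I * ∫ x, w x * ρ x := by
      rw [← integral_const_mul, ← integral_sub (hint hψ hψc) ((hint hρ hρc).const_mul I)]
      congr 1; ext x; simp only [η]; ring
    have h2 : ∫ x, ψ x • (w x - ∫ x, w x * ρ x) = (∫ x, w x * ψ x) - I * ∫ x, w x * ρ x := by
      rw [mul_comm I, ← integral_const_mul, ← integral_sub (hint hψ hψc) (hψi.const_mul _)]
      congr 1; ext x; simp only [smul_eq_mul]; ring
    rw [h2, ← h1, h0]; simp
  filter_upwards [hz] with x hx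
  linarith

theorem HasWeakDeriv.ae_eq_integral_Iic {f v : ℝ → ℝ} (h : HasWeakDeriv f v) (hf : Integrable f)
    (hv : Integrable v) : f =ᵐ[volume] fun x => ∫ t in Iic x, v t := by
  obtain ⟨hF, hd⟩ := isACL1_integral_Iic hv
  set F : ℝ → ℝ := fun x => ∫ t in Iic x, v t with hFdef
  obtain ⟨c, hc⟩ : ∃ c : ℝ, (fun x => f x + (-1) * F x) =ᵐ[volume] fun _ => c := by
    refine HasWeakDeriv.ae_eq_const ((h.add (hF.hasWeakDeriv.const_mul (-1))).congr_ae
      (ae_eq_refl _) ?_)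
    filter_upwards [hd] with x hx
    simp [hx]
  -- `F` tends to `0` at `-∞` and differs from an integrable function by the constant `c`.
  have hFc : Integrable (fun x => F x + c) := by
    refine hf.congr ?_
    filter_upwards [hc] with x hx
    linarith
  have hF0 : Tendsto F atBot (𝓝 0) := by
    have : Tendsto (fun x => (∫ t in Iic (0 : ℝ), v t) - ∫ t in x..0, v t) atBot (𝓝 0) := by
      have := (tendsto_const_nhds (x := ∫ t in Iic (0 : ℝ), v t)).sub
        (intervalIntegral_tendsto_integral_Iic (0 : ℝ) hv.integrableOn tendsto_id)
      simpa using this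
    refine this.congr fun x => ?_
    rw [← intervalIntegral.integral_Iic_sub_Iic hv.integrableOn hv.integrableOn]
    simp [hFdef]
  have hc0 : 0 + c = 0 :=
    IntegrableAtFilter.eq_zero_of_tendsto (hFc.integrableAtFilter atBot) (fun s hs => by
      obtain ⟨b, hb⟩ := mem_atBot_sets.1 hs
      exact top_le_iff.1 ((Real.volume_Iic (a := b)) ▸ measure_mono hb))
      (hF0.add tendsto_const_nhds)
  filter_upwards [hc] with x hx
  linarith
/-! ### Averages over intervals with a prescribed endpoint -/

/-- The average of `p` over the interval with endpoints `x` and `x + h`, for `h` of either sign.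
The parametrization by `[0, 1]` makes the value at `h = 0` equal to `p x`. -/
noncomputable def segAvg (p : ℝ → ℝ) (x h : ℝ) : ℝ := ∫ t in (0 : ℝ)..1, p (x + h * t)

/-- The one-sided maximal function: the supremum of the averages of `p` over the intervals
`[x, x + h]`, `h ≥ 0`, where `h = 0` contributes the value `p x`. -/
noncomputable def rightMax (p : ℝ → ℝ) (x : ℝ) : ℝ := ⨆ h : ℝ≥0, segAvg p x h

/-- A nonnegative continuous representative of an element of `W^{1,1}(ℝ)`. -/
structure IsNonnegW11 (p : ℝ → ℝ) : Prop where
  acl1 : IsACL1 p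
  integrable : Integrable p volume
  nonneg : ∀ x, 0 ≤ p x

@[simp] theorem segAvg_zero (p : ℝ → ℝ) (x : ℝ) : segAvg p x 0 = p x := by simp [segAvg]

theorem mul_segAvg (p : ℝ → ℝ) (x h : ℝ) : h * segAvg p x h = ∫ t in x..(x + h), p t := by
  simp [segAvg]

theorem continuous_segAvg {p : ℝ → ℝ} (hp : Continuous p) :
    Continuous fun z : ℝ × ℝ => segAvg p z.1 z.2 := by
  unfold segAvg
  exact intervalIntegral.continuous_parametric_intervalIntegral_of_continuous'
    (f := fun (z : ℝ × ℝ) t => p (z.1 + z.2 * t)) (by fun_prop) 0 1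

theorem segAvg_le_of_le {p : ℝ → ℝ} (hp : Continuous p) {x h C : ℝ}
    (hC : ∀ t ∈ Icc (0 : ℝ) 1, p (x + h * t) ≤ C) : segAvg p x h ≤ C := by
  have h1 : segAvg p x h ≤ ∫ _ in (0 : ℝ)..1, C :=
    intervalIntegral.integral_mono_on zero_le_one
      ((by fun_prop : Continuous fun t => p (x + h * t)).intervalIntegrable _ _)
      intervalIntegrable_const hC
  simpa using h1

theorem segAvg_nonneg {p : ℝ → ℝ} (hp : ∀ x, 0 ≤ p x) (x h : ℝ) : 0 ≤ segAvg p x h :=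
  intervalIntegral.integral_nonneg zero_le_one fun _ _ => hp _

theorem abs_segAvg_sub_le {p q : ℝ → ℝ} (hp : Continuous p) (hq : Continuous q) {ε : ℝ}
    (h : ∀ x, |p x - q x| ≤ ε) (x k : ℝ) : |segAvg p x k - segAvg q x k| ≤ ε := by
  unfold segAvg
  rw [← intervalIntegral.integral_sub
    ((by fun_prop : Continuous fun t => p (x + k * t)).intervalIntegrable _ _)
    ((by fun_prop : Continuous fun t => q (x + k * t)).intervalIntegrable _ _)]
  have := intervalIntegral.norm_integral_le_of_norm_le_const (a := (0 : ℝ)) (b := 1)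
    (f := fun t => p (x + k * t) - q (x + k * t)) (C := ε) fun t _ => h _
  simpa using this

theorem segAvg_add_left (p : ℝ → ℝ) (x s h : ℝ) :
    segAvg p (x + s) h = segAvg (fun t => p (t + s)) x h := by
  simp only [segAvg]
  congr 1; ext t; congr 1; ring

theorem segAvg_comp_neg (p : ℝ → ℝ) (x h : ℝ) :
    segAvg (fun t => p (-t)) (-x) h = segAvg p x (-h) := by
  simp only [segAvg]
  congr 1; ext t; congr 1; ring

namespace IsNonnegW11

variable {p q : ℝ → ℝ} {x : ℝ}

theorem continuous (hp : IsNonnegW11 p) : Continuous p := hp.acl1.continuous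

theorem le_integral (hp : IsNonnegW11 p) (x : ℝ) : p x ≤ ∫ t, |deriv p t| := by
  have h : Tendsto (fun y => p x - p y) atTop (𝓝 (p x - 0)) :=
    tendsto_const_nhds.sub (hp.acl1.tendsto_atTop_zero hp.integrable)
  rw [sub_zero] at h
  exact le_of_tendsto h (Eventually.of_forall fun y =>
    (le_abs_self _).trans (hp.acl1.abs_sub_le_integral y x))

theorem tendsto_cocompact (hp : IsNonnegW11 p) : Tendsto p (cocompact ℝ) (𝓝 0) := by
  rw [cocompact_eq_atBot_atTop]
  exact (hp.acl1.tendsto_atBot_zero hp.integrable).sup (hp.acl1.tendsto_atTop_zero hp.integrable)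

theorem uniformContinuous (hp : IsNonnegW11 p) : UniformContinuous p :=
  hp.continuous.uniformContinuous_of_tendsto_cocompact hp.tendsto_cocompact

theorem comp_add (hp : IsNonnegW11 p) (s : ℝ) : IsNonnegW11 (fun x => p (x + s)) where
  acl1 := by
    refine (isACL1_of_integral_eq_sub (v := fun x => deriv p (x + s))
      (hp.acl1.integrable_deriv.comp_add_right s) fun x y => ?_).1
    rw [intervalIntegral.integral_comp_add_right (fun t => deriv p t), hp.acl1.integral_deriv]
  integrable := hp.integrable.comp_add_right s
  nonneg _ := hp.nonneg _

theorem comp_neg (hp : IsNonnegW11 p) : IsNonnegW11 (fun x => p (-x)) where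
  acl1 := hp.acl1.comp_neg
  integrable := hp.integrable.comp_neg
  nonneg _ := hp.nonneg _

/-! ### The one-sided maximal function -/

theorem segAvg_le_bound (hp : IsNonnegW11 p) (x h : ℝ) : segAvg p x h ≤ ∫ t, |deriv p t| :=
  segAvg_le_of_le hp.continuous fun _ _ => hp.le_integral _

theorem segAvg_le_div (hp : IsNonnegW11 p) (x : ℝ) {h : ℝ} (hh : 0 < h) :
    segAvg p x h ≤ (∫ t, p t) / h := by
  rw [le_div_iff₀ hh, mul_comm, mul_segAvg,
    intervalIntegral.integral_of_le (by linarith)]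
  exact setIntegral_le_integral hp.integrable (ae_of_all _ hp.nonneg)

theorem segAvg_le_rightMax (hp : IsNonnegW11 p) (x : ℝ) {h : ℝ} (hh : 0 ≤ h) :
    segAvg p x h ≤ rightMax p x :=
  le_ciSup (f := fun h : ℝ≥0 => segAvg p x h)
    ⟨∫ t, |deriv p t|, by rintro _ ⟨k, rfl⟩; exact hp.segAvg_le_bound x k⟩ ⟨h, hh⟩

theorem le_rightMax (hp : IsNonnegW11 p) (x : ℝ) : p x ≤ rightMax p x := by
  simpa using hp.segAvg_le_rightMax x le_rfl

theorem rightMax_nonneg (hp : IsNonnegW11 p) (x : ℝ) : 0 ≤ rightMax p x :=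
  (hp.nonneg x).trans (hp.le_rightMax x)

theorem exists_segAvg_eq_rightMax (hp : IsNonnegW11 p) (x : ℝ) :
    ∃ h, 0 ≤ h ∧ segAvg p x h = rightMax p x := by
  suffices ∃ h, 0 ≤ h ∧ ∀ k, 0 ≤ k → segAvg p x k ≤ segAvg p x h by
    obtain ⟨h, hh, hk⟩ := this
    exact ⟨h, hh, (hp.segAvg_le_rightMax x hh).antisymm (ciSup_le fun k => hk k k.2)⟩
  by_cases hall : ∀ k, 0 ≤ k → segAvg p x k ≤ 0
  · exact ⟨0, le_rfl, fun k hk => (hall k hk).trans (segAvg_nonneg hp.nonneg _ _)⟩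
  push Not at hall
  obtain ⟨k, hk, hpos⟩ := hall
  set c := segAvg p x k
  -- Averages over intervals longer than `‖p‖₁ / c` are smaller than `c`.
  obtain ⟨h, hh, hmax⟩ := (isCompact_Icc (a := (0 : ℝ)) (b := max k ((∫ t, p t) / c))).exists_isMaxOn
    ⟨k, hk, le_max_left _ _⟩
    ((continuous_segAvg hp.continuous).comp (Continuous.prodMk_right x)).continuousOn
  refine ⟨h, hh.1, fun l hl => ?_⟩
  rcases le_or_gt l (max k ((∫ t, p t) / c)) with h1 | h1
  · exact hmax ⟨hl, h1⟩
  · have hl0 : 0 < l := lt_of_le_of_lt (hk.trans (le_max_left _ _)) h1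
    have h2 : (∫ t, p t) / l ≤ c := by
      rw [div_le_comm₀ hl0 hpos]
      exact ((le_max_right _ _).trans_lt h1).le
    exact ((hp.segAvg_le_div x hl0).trans h2).trans (hmax ⟨hk, le_max_left _ _⟩)

theorem rightMax_le_add (hp : IsNonnegW11 p) (hq : IsNonnegW11 q) {ε : ℝ}
    (h : ∀ x, |p x - q x| ≤ ε) (x : ℝ) : rightMax p x ≤ rightMax q x + ε :=
  ciSup_le fun k => by
    have := (abs_le.1 (abs_segAvg_sub_le hp.continuous hq.continuous h x k)).2
    linarith [hq.segAvg_le_rightMax x k.coe_nonneg]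

theorem abs_rightMax_sub_le (hp : IsNonnegW11 p) (hq : IsNonnegW11 q) {ε : ℝ}
    (h : ∀ x, |p x - q x| ≤ ε) (x : ℝ) : |rightMax p x - rightMax q x| ≤ ε := by
  have h1 := hp.rightMax_le_add hq h x
  have h2 := hq.rightMax_le_add hp (fun x => by rw [abs_sub_comm]; exact h x) x
  exact abs_le.2 ⟨by linarith, by linarith⟩

theorem continuous_rightMax (hp : IsNonnegW11 p) : Continuous (rightMax p) := by
  refine (Metric.uniformContinuous_iff.2 fun ε hε => ?_).continuous
  obtain ⟨δ, hδ, hpδ⟩ := Metric.uniformContinuous_iff.1 hp.uniformContinuous (ε / 2) (half_pos hε)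
  refine ⟨δ, hδ, fun x y hxy => ?_⟩
  have h1 : rightMax p x = rightMax (fun t => p (t + (x - y))) y := by
    simp only [rightMax, ← segAvg_add_left]
    congr; ext h; congr 1; ring
  rw [Real.dist_eq, h1]
  refine ((hp.comp_add _).abs_rightMax_sub_le hp (ε := ε / 2) (fun t => ?_) y).trans_lt
    (half_lt_self hε)
  refine (hpδ (a := t + (x - y)) (b := t) ?_).le
  rw [Real.dist_eq] at hxy ⊢
  simpa using hxy

/-- Where the one-sided maximal function is differentiable, its derivative is determined by any
maximizing interval `[x, x + h]`, since moving the left endpoint only gives a lower bound. -/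
theorem deriv_rightMax_of_pos (hp : IsNonnegW11 p) {h : ℝ} (hh : 0 < h)
    (hd : DifferentiableAt ℝ (rightMax p) x) (heq : segAvg p x h = rightMax p x) :
    deriv (rightMax p) x = (rightMax p x - p x) / h := by
  have hint : HasDerivAt (fun y => ∫ t in y..(x + h), p t) (-p x) x :=
    intervalIntegral.integral_hasDerivAt_left (hp.continuous.intervalIntegrable _ _)
      hp.continuous.stronglyMeasurable.stronglyMeasurableAtFilter hp.continuous.continuousAt
  have hlen : HasDerivAt (fun y => x + h - y) (-1) x := by
    simpa using (hasDerivAt_id x).const_sub (x + h)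
  have hquot := hint.fun_div hlen (by simp [hh.ne'])
  have hmin : IsLocalMin (fun y => rightMax p y - (∫ t in y..(x + h), p t) / (x + h - y)) x := by
    filter_upwards [gt_mem_nhds (show x < x + h by linarith)] with y hy
    have hy' : 0 < x + h - y := by linarith
    have h1 : (∫ t in x..(x + h), p t) / (x + h - x) = rightMax p x := by
      rw [← heq, ← mul_segAvg, add_sub_cancel_left, mul_div_cancel_left₀ _ hh.ne']
    have h2 : (∫ t in y..(x + h), p t) / (x + h - y) = segAvg p y (x + h - y) := by
      rw [div_eq_iff hy'.ne', mul_comm, mul_segAvg]; simp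
    rw [h1, h2]
    linarith [hp.segAvg_le_rightMax y hy'.le]
  have h0 := hmin.deriv_eq_zero
  rw [deriv_fun_sub hd hquot.differentiableAt, hquot.deriv, ← mul_segAvg, heq] at h0
  have : deriv (rightMax p) x = (-p x * (x + h - x) - h * rightMax p x * -1) / (x + h - x) ^ 2 := by
    linarith
  rw [this, add_sub_cancel_left]
  field_simp
  ring

theorem deriv_rightMax_of_eq (hp : IsNonnegW11 p) (hd : DifferentiableAt ℝ (rightMax p) x)
    (hdp : DifferentiableAt ℝ p x) (heq : p x = rightMax p x) :
    deriv (rightMax p) x = deriv p x := by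
  have hmin : IsLocalMin (fun y => rightMax p y - p y) x :=
    Eventually.of_forall fun y => by simpa [← heq] using hp.le_rightMax y
  have h0 := hmin.deriv_eq_zero
  rw [deriv_fun_sub hd hdp] at h0
  linarith

theorem deriv_rightMax_nonneg (hp : IsNonnegW11 p) (hd : DifferentiableAt ℝ (rightMax p) x)
    (hlt : p x < rightMax p x) : 0 ≤ deriv (rightMax p) x := by
  obtain ⟨h, hh, heq⟩ := hp.exists_segAvg_eq_rightMax x
  have hpos : 0 < h := hh.lt_of_ne fun h0 => by rw [← h0, segAvg_zero] at heq; exact hlt.ne heq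
  rw [hp.deriv_rightMax_of_pos hpos hd heq]
  exact div_nonneg (by linarith) hh

/-! ### Absolute continuity of the one-sided maximal function -/

/-- Averages over intervals of length at least `δ` depend on the endpoint in a Lipschitz way, so
the excess of `rightMax p` over `p + ε` is absolutely continuous. -/
theorem ac_truncated_excess (hp : IsNonnegW11 p) {ε : ℝ} (hε : 0 < ε) (a b : ℝ) :
    AbsolutelyContinuousOnInterval (fun x => max (rightMax p x - p x - ε) 0) a b := by
  obtain ⟨δ, hδ, hpδ⟩ := Metric.uniformContinuous_iff.1 hp.uniformContinuous ε hε
  set B := ∫ t, |deriv p t| with hB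
  have hB0 : 0 ≤ B := integral_nonneg fun _ => abs_nonneg _
  -- The maximal function restricted to intervals of length at least `δ / 2`.
  let g : ℝ → ℝ := fun x => ⨆ h : Ici (δ / 2), segAvg p x h
  have hbdd : ∀ x, BddAbove (range fun h : Ici (δ / 2) => segAvg p x h) := fun x =>
    ⟨B, by rintro _ ⟨k, rfl⟩; exact hp.segAvg_le_bound x k⟩
  have hprim : ∀ x y, |∫ t in x..y, p t| ≤ B * |y - x| := fun x y =>
    intervalIntegral.norm_integral_le_of_norm_le_const fun t _ => by
      rw [Real.norm_of_nonneg (hp.nonneg t)]; exact hp.le_integral t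
  have hlip : LipschitzWith (Real.toNNReal (4 * B / δ)) g := by
    refine LipschitzWith.of_le_add_mul _ fun x y => ?_
    rw [Real.coe_toNNReal _ (by positivity)]
    refine ciSup_le fun h => ?_
    have hh : δ / 2 ≤ (h : ℝ) := h.2
    have hh0 : 0 < (h : ℝ) := by linarith
    refine le_trans ?_ (add_le_add_left (le_ciSup (hbdd y) h) _)
    have hi : ∀ a b, IntervalIntegrable p volume a b := hp.continuous.intervalIntegrable
    have h1 : (h : ℝ) * (segAvg p x h - segAvg p y h) =
        (∫ t in x..y, p t) - ∫ t in (x + h)..(y + h), p t := by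
      rw [mul_sub, mul_segAvg, mul_segAvg,
        intervalIntegral.integral_interval_sub_interval_comm (hi _ _) (hi _ _) (hi _ _)]
    have h2 : (h : ℝ) * (segAvg p x h - segAvg p y h) ≤ 2 * B * dist x y := by
      rw [h1, dist_comm, Real.dist_eq]
      have e1 := (abs_le.1 (hprim x y)).2
      have e2 := (abs_le.1 (hprim (x + h) (y + h))).1
      rw [add_sub_add_right_eq_sub] at e2
      linarith
    have h3 : segAvg p x h - segAvg p y h ≤ 4 * B / δ * dist x y := by
      by_contra hcon
      push Not at hcon
      have h4 : 0 ≤ 4 * B / δ * dist x y := by positivity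
      have h5 : δ / 2 * (4 * B / δ * dist x y) < h * (segAvg p x h - segAvg p y h) :=
        mul_lt_mul' hh hcon h4 hh0
      have h6 : δ / 2 * (4 * B / δ * dist x y) = 2 * B * dist x y := by field_simp; ring
      linarith
    linarith
  have hgle : ∀ x, g x ≤ rightMax p x := fun x => by
    have : Nonempty (Ici (δ / 2)) := ⟨⟨δ / 2, self_mem_Ici⟩⟩
    exact ciSup_le fun h => hp.segAvg_le_rightMax x ((half_pos hδ).le.trans h.2)
  have heq : (fun x => max (rightMax p x - p x - ε) 0) = fun x => max (g x - p x - ε) 0 := by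
    ext x
    refine le_antisymm ?_ (max_le_max_right 0 (by linarith [hgle x]))
    obtain ⟨h, hh, hmax⟩ := hp.exists_segAvg_eq_rightMax x
    rcases le_or_gt (δ / 2) h with h1 | h1
    · have : segAvg p x h ≤ g x := le_ciSup (hbdd x) ⟨h, h1⟩
      exact max_le_max_right 0 (by linarith)
    · refine max_le (le_trans ?_ (le_max_right _ _)) (le_max_right _ _)
      have : segAvg p x h ≤ p x + ε := segAvg_le_of_le hp.continuous fun t ht => by
        have := hpδ (a := x + h * t) (b := x) (by
          rw [Real.dist_eq, add_sub_cancel_left, abs_of_nonneg (mul_nonneg hh ht.1)]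
          nlinarith [ht.1, ht.2])
        rw [Real.dist_eq] at this
        linarith [(abs_lt.1 this).2]
      linarith
  have hconst : ∀ c : ℝ, AbsolutelyContinuousOnInterval (fun _ : ℝ => c) a b := fun c =>
    (LipschitzWith.const (α := ℝ) c).lipschitzOnWith.absolutelyContinuousOnInterval
  rw [heq]
  exact ((hlip.lipschitzOnWith.absolutelyContinuousOnInterval.fun_sub (hp.acl1.ac a b)).fun_sub
    (hconst ε)).max (hconst 0)

theorem deriv_truncated_excess (hp : IsNonnegW11 p) (ε x : ℝ) :
    deriv (fun x => max (rightMax p x - p x - ε) 0) x =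
      indicator {x | ε < rightMax p x - p x} (deriv fun x => rightMax p x - p x) x := by
  by_cases hx : ε < rightMax p x - p x
  · rw [indicator_of_mem (by exact hx)]
    have hc : Continuous fun x => rightMax p x - p x := hp.continuous_rightMax.sub hp.continuous
    have : (fun x => max (rightMax p x - p x - ε) 0) =ᶠ[𝓝 x] fun x => rightMax p x - p x - ε := by
      filter_upwards [hc.continuousAt.eventually_const_lt hx] with y hy
      exact max_eq_left (by linarith)
    rw [this.deriv_eq, deriv_sub_const]
  · rw [indicator_of_notMem (by exact hx)]
    refine IsLocalMin.deriv_eq_zero (Eventually.of_forall fun y => ?_)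
    simp only
    rw [max_eq_right (by linarith : rightMax p x - p x - ε ≤ 0)]
    exact le_max_right _ _

/-- The one-sided maximal function of a `W^{1,1}` function is absolutely continuous, with
integrable derivative: where it exceeds `p` it is nondecreasing, so the `L¹` norm of the derivative
of the truncated excess is controlled by its (bounded) increments. -/
theorem isACL1_rightMax (hp : IsNonnegW11 p) : IsACL1 (rightMax p) := by
  set u : ℝ → ℝ := fun x => rightMax p x - p x with hu
  set B := ∫ t, |deriv p t| with hB
  have huc : Continuous u := hp.continuous_rightMax.sub hp.continuous
  have hu0 : ∀ x, 0 ≤ u x := fun x => sub_nonneg.2 (hp.le_rightMax x)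
  have huB : ∀ x, u x ≤ B := fun x => by
    have : rightMax p x ≤ B := ciSup_le fun h => hp.segAvg_le_bound x h
    simp only [hu]; linarith [hp.nonneg x]
  let ε : ℕ → ℝ := fun n => 1 / ((n : ℝ) + 1)
  have hε : ∀ n, 0 < ε n := fun n => Nat.one_div_pos_of_nat
  have hε0 : Tendsto ε atTop (𝓝 0) := tendsto_one_div_add_atTop_nhds_zero_nat
  let w : ℕ → ℝ → ℝ := fun n x => max (u x - ε n) 0
  have hwac : ∀ n a b, AbsolutelyContinuousOnInterval (w n) a b := fun n =>
    hp.ac_truncated_excess (hε n)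
  have hwd : ∀ n x, deriv (w n) x = indicator {x | ε n < u x} (deriv u) x := fun n x =>
    hp.deriv_truncated_excess (ε n) x
  have hsign : ∀ n, ∀ᵐ x, |deriv (w n) x| ≤ deriv (w n) x + 2 * |deriv p x| := by
    intro n
    filter_upwards [ae_of_forall_ae_uIcc fun a b => (hwac n a b).ae_differentiableAt,
      hp.acl1.ae_differentiableAt] with x hx hpx
    rw [hwd]
    by_cases hmem : ε n < u x
    · rw [indicator_of_mem (by exact hmem)]
      have hev : u =ᶠ[𝓝 x] fun y => w n y + ε n := by
        filter_upwards [huc.continuousAt.eventually_const_lt hmem] with y hy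
        simp only [w]
        rw [max_eq_left (by linarith)]; ring
      have hux : DifferentiableAt ℝ u x := (hx.add_const _).congr_of_eventuallyEq hev
      have hgx : DifferentiableAt ℝ (rightMax p) x := by
        have : rightMax p = fun y => u y + p y := by ext y; simp [hu]
        rw [this]; exact hux.add hpx
      have hg := hp.deriv_rightMax_nonneg hgx (by have := hε n; simp only [hu] at hmem; linarith)
      have : deriv u x = deriv (rightMax p) x - deriv p x := deriv_fun_sub hgx hpx
      rw [abs_le]
      constructor
      · rw [this]; linarith [le_abs_self (deriv p x), neg_abs_le (deriv p x)]
      · linarith [abs_nonneg (deriv p x)]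
    · rw [indicator_of_notMem (by exact hmem)]; simp
  have hDopen : MeasurableSet {x | 0 < u x} := measurableSet_lt measurable_const huc.measurable
  have hDn : ∀ n, MeasurableSet {x | ε n < u x} := fun n =>
    measurableSet_lt measurable_const huc.measurable
  have hint : ∀ n : ℕ, IntegrableOn (deriv (w n)) (Icc (-(n : ℝ)) n) := fun n => by
    have hn : -(n : ℝ) ≤ n := by linarith [n.cast_nonneg (α := ℝ)]
    rw [integrableOn_Icc_iff_integrableOn_Ioc, ← intervalIntegrable_iff_integrableOn_Ioc_of_le hn]
    exact (hwac n _ _).intervalIntegrable_deriv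
  have hnorm : ∀ n : ℕ, ∫ x in Icc (-(n : ℝ)) n, |deriv (w n) x| ≤ B + 2 * B := fun n => by
    have hn : -(n : ℝ) ≤ n := by linarith [n.cast_nonneg (α := ℝ)]
    have hpi : IntegrableOn (fun x => 2 * |deriv p x|) (Icc (-(n : ℝ)) n) :=
      (hp.acl1.integrable_deriv.norm.const_mul 2).integrableOn
    calc ∫ x in Icc (-(n : ℝ)) n, |deriv (w n) x|
        ≤ ∫ x in Icc (-(n : ℝ)) n, (deriv (w n) x + 2 * |deriv p x|) :=
          integral_mono_ae (hint n).norm ((hint n).add hpi) (ae_restrict_of_ae (hsign n))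
      _ = (w n n - w n (-n)) + ∫ x in Icc (-(n : ℝ)) n, 2 * |deriv p x| := by
          rw [integral_add (hint n) hpi, integral_Icc_eq_integral_Ioc,
            ← intervalIntegral.integral_of_le hn, (hwac n _ _).integral_deriv_eq_sub]
      _ ≤ B + 2 * B := by
          have h1 : w n n ≤ B := max_le (by linarith [huB n, hε n])
            (integral_nonneg fun _ => abs_nonneg _)
          have h2 : 0 ≤ w n (-n) := le_max_right _ _
          have h3 : ∫ x in Icc (-(n : ℝ)) n, 2 * |deriv p x| ≤ 2 * B := by
            rw [hB, ← integral_const_mul]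
            exact setIntegral_le_integral (hp.acl1.integrable_deriv.norm.const_mul 2)
              (ae_of_all _ fun _ => by positivity)
          linarith
  -- Exhaust `{u > 0}` by the sets on which the truncated excesses have derivative `u'`.
  have hcover : AECover (volume.restrict {x | 0 < u x}) atTop
      fun n : ℕ => Icc (-(n : ℝ)) n ∩ {x | ε n < u x} := by
    refine ⟨?_, fun n => measurableSet_Icc.inter (hDn n)⟩
    filter_upwards [ae_restrict_mem hDopen] with x hx
    filter_upwards [hε0.eventually_lt_const (show 0 < u x from hx),
      eventually_ge_atTop ⌈|x|⌉₊] with n h1 h2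
    exact ⟨abs_le.1 ((Nat.le_ceil _).trans (Nat.cast_le.2 h2)), h1⟩
  have hsub : ∀ n : ℕ, (volume.restrict {x | 0 < u x}).restrict
      (Icc (-(n : ℝ)) n ∩ {x | ε n < u x}) =
        (volume.restrict (Icc (-(n : ℝ)) n)).restrict {x | ε n < u x} := fun n => by
    rw [Measure.restrict_restrict (measurableSet_Icc.inter (hDn n)),
      Measure.restrict_restrict (hDn n)]
    congr 1
    ext x
    simp only [mem_inter_iff, mem_ofPred_eq]
    exact ⟨fun h => ⟨h.1.2, h.1.1⟩, fun h => ⟨⟨h.2, h.1⟩, (hε n).trans h.1⟩⟩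
  have hwd' : ∀ n, deriv (w n) = indicator {x | ε n < u x} (deriv u) := fun n => funext (hwd n)
  have hW : Integrable (indicator {x | 0 < u x} (deriv u)) := by
    rw [integrable_indicator_iff hDopen]
    refine hcover.integrable_of_integral_norm_bounded (B + 2 * B) (fun n => ?_)
      (Eventually.of_forall fun n => ?_)
    · rw [IntegrableOn, hsub, ← IntegrableOn, ← integrable_indicator_iff (hDn n), ← hwd']
      exact hint n
    · rw [hsub, ← integral_indicator (hDn n)]
      refine le_trans (le_of_eq ?_) (hnorm n)
      refine integral_congr_ae (ae_of_all _ fun x => ?_)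
      simp only [hwd, ← Real.norm_eq_abs, norm_indicator_eq_indicator_norm]
  have hincr : ∀ x y, ∫ t in x..y, indicator {x | 0 < u x} (deriv u) t = u y - u x := by
    intro x y
    have h1 : Tendsto (fun n => ∫ t in x..y, deriv (w n) t) atTop
        (𝓝 (∫ t in x..y, indicator {x | 0 < u x} (deriv u) t)) := by
      refine intervalIntegral.tendsto_integral_filter_of_dominated_convergence
        (fun t => ‖indicator {x | 0 < u x} (deriv u) t‖)
        (Eventually.of_forall fun n => (measurable_deriv _).aestronglyMeasurable)
        (Eventually.of_forall fun n => ae_of_all _ fun t _ => ?_) hW.norm.intervalIntegrable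
        (ae_of_all _ fun t _ => ?_)
      · rw [hwd]
        by_cases ht : ε n < u t
        · rw [indicator_of_mem (by exact ht), indicator_of_mem (by exact (hε n).trans ht)]
        · rw [indicator_of_notMem (by exact ht)]; simp
      · refine tendsto_const_nhds.congr' ?_
        by_cases ht : 0 < u t
        · filter_upwards [hε0.eventually_lt_const ht] with n hn
          rw [hwd, indicator_of_mem (s := {x | ε n < u x}) hn,
            indicator_of_mem (s := {x | 0 < u x}) ht]
        · refine Eventually.of_forall fun n => ?_
          simp only
          rw [hwd, indicator_of_notMem (s := {x | 0 < u x}) ht, indicator_of_notMem]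
          exact fun h => ht ((hε n).trans h)
    have hwlim : ∀ z, Tendsto (fun n => w n z) atTop (𝓝 (u z)) := fun z => by
      have := ((tendsto_const_nhds (x := u z)).sub hε0).max (tendsto_const_nhds (x := (0 : ℝ)))
      simpa [max_eq_left (hu0 z)] using this
    refine tendsto_nhds_unique h1 (((hwlim y).sub (hwlim x)).congr fun n => ?_)
    rw [(hwac n x y).integral_deriv_eq_sub]
  refine (isACL1_of_integral_eq_sub (hW.add hp.acl1.integrable_deriv) fun x y => ?_).1
  simp only [Pi.add_apply]
  rw [intervalIntegral.integral_add hW.intervalIntegrable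
    hp.acl1.integrable_deriv.intervalIntegrable, hincr, hp.acl1.integral_deriv]
  simp only [hu]; ring

theorem neg_abs_deriv_le_deriv_rightMax (hp : IsNonnegW11 p) :
    ∀ᵐ x, -|deriv p x| ≤ deriv (rightMax p) x := by
  filter_upwards [hp.isACL1_rightMax.ae_differentiableAt, hp.acl1.ae_differentiableAt] with x hx hpx
  rcases (hp.le_rightMax x).eq_or_lt with h | h
  · rw [hp.deriv_rightMax_of_eq hx hpx h]; exact neg_abs_le _
  · exact (neg_nonpos.2 (abs_nonneg _)).trans (hp.deriv_rightMax_nonneg hx h)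

theorem tendsto_rightMax_cocompact (hp : IsNonnegW11 p) :
    Tendsto (rightMax p) (cocompact ℝ) (𝓝 0) := by
  refine Metric.tendsto_nhds.2 fun ε hε => ?_
  have hε2 := half_pos hε
  obtain ⟨R, hR⟩ : ∃ R : ℝ, ∀ t, R < |t| → p t ≤ ε / 2 := by
    have := (hasBasis_cobounded_norm (E := ℝ)).eventually_iff.1
      (by rw [Metric.cobounded_eq_cocompact]; exact hp.tendsto_cocompact.eventually_le_const hε2)
    obtain ⟨R, -, hR⟩ := this
    exact ⟨R, fun t ht => hR ht.le⟩
  set H := (∫ t, p t) / (ε / 2)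
  have hev : ∀ᶠ x : ℝ in cocompact ℝ, R + H < |x| :=
    (tendsto_norm_cocompact_atTop (E := ℝ)).eventually_gt_atTop _
  filter_upwards [hev] with x hx
  rw [Real.dist_eq, sub_zero, abs_of_nonneg (hp.rightMax_nonneg x)]
  refine lt_of_le_of_lt ?_ (half_lt_self hε)
  refine ciSup_le fun h => ?_
  rcases le_or_gt (h : ℝ) H with h1 | h1
  · refine segAvg_le_of_le hp.continuous fun t ht => hR _ ?_
    have h2 : |(h : ℝ) * t| ≤ H := by
      rw [abs_of_nonneg (mul_nonneg h.coe_nonneg ht.1)]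
      nlinarith [ht.1, ht.2, h.coe_nonneg]
    have h3 := abs_sub_abs_le_abs_sub x (-((h : ℝ) * t))
    rw [abs_neg, sub_neg_eq_add] at h3
    linarith
  · have hH : 0 ≤ H := div_nonneg (integral_nonneg hp.nonneg) hε2.le
    have h0 : 0 < (h : ℝ) := hH.trans_lt h1
    refine (hp.segAvg_le_div x h0).trans ?_
    rw [div_le_comm₀ h0 hε2]
    exact h1.le

theorem integral_deriv_rightMax (hp : IsNonnegW11 p) : ∫ x, deriv (rightMax p) x = 0 := by
  have h1 := intervalIntegral_tendsto_integral hp.isACL1_rightMax.integrable_deriv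
    tendsto_neg_atTop_atBot tendsto_id
  have h := hp.tendsto_rightMax_cocompact
  rw [cocompact_eq_atBot_atTop, tendsto_sup] at h
  refine tendsto_nhds_unique h1 ?_
  have := h.2.sub (h.1.comp tendsto_neg_atTop_atBot)
  rw [sub_zero] at this
  refine this.congr fun x => ?_
  rw [hp.isACL1_rightMax.integral_deriv]; rfl

end IsNonnegW11
/-! ### Continuity of the one-sided maximal function -/

theorem integrable_tsum_of_summable_integral {F : ℕ → ℝ → ℝ} (hF : ∀ j, Integrable (F j))
    (h0 : ∀ j x, 0 ≤ F j x) (hs : Summable fun j => ∫ x, F j x) :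
    Integrable (fun x => ∑' j, F j x) ∧ ∀ᵐ x, Summable fun j => F j x := by
  have hm : ∀ j, AEMeasurable (fun x => ENNReal.ofReal (F j x)) volume := fun j =>
    (hF j).1.aemeasurable.ennreal_ofReal
  have hfin : ∫⁻ x, ∑' j, ENNReal.ofReal (F j x) ≠ ⊤ := by
    rw [lintegral_tsum hm]
    simp_rw [← ofReal_integral_eq_lintegral_ofReal (hF _) (ae_of_all _ (h0 _))]
    exact hs.tsum_ofReal_ne_top
  have hreal : ∀ x, (∑' j, ENNReal.ofReal (F j x)).toReal = ∑' j, F j x := fun x => by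
    rw [ENNReal.tsum_toReal_eq fun j => ENNReal.ofReal_ne_top]
    simp [h0]
  constructor
  · simpa only [hreal] using integrable_toReal_of_lintegral_ne_top (AEMeasurable.tsum hm) hfin
  · filter_upwards [ae_lt_top' (AEMeasurable.tsum hm) hfin] with x hx
    simpa [h0] using ENNReal.summable_toReal hx.ne

namespace IsACL1

variable {u v : ℝ → ℝ}

theorem abs_increment_sub_le (hu : IsACL1 u) (hv : IsACL1 v) {x y : ℝ} (hxy : x ≤ y) :
    |(u y - u x) - (v y - v x)| ≤ ∫ t in x..y, |deriv u t - deriv v t| := by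
  rw [← hu.integral_deriv, ← hv.integral_deriv, ← intervalIntegral.integral_sub
    hu.integrable_deriv.intervalIntegrable hv.integrable_deriv.intervalIntegrable]
  exact intervalIntegral.abs_integral_le_integral_abs hxy

theorem abs_sub_le_integral_of_tendsto (hu : IsACL1 u) (hv : IsACL1 v)
    (hu0 : Tendsto u atTop (𝓝 0)) (hv0 : Tendsto v atTop (𝓝 0)) (x : ℝ) :
    |u x - v x| ≤ ∫ t, |deriv u t - deriv v t| := by
  have h : Tendsto (fun y => |(u y - u x) - (v y - v x)|) atTop (𝓝 |(0 - u x) - (0 - v x)|) :=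
    ((hu0.sub tendsto_const_nhds).sub (hv0.sub tendsto_const_nhds)).abs
  have h' : |u x - v x| = |(0 - u x) - (0 - v x)| := by rw [abs_sub_comm]; congr 1; ring
  rw [h']
  refine le_of_tendsto h ((eventually_ge_atTop x).mono fun y hy => ?_)
  refine (hu.abs_increment_sub_le hv hy).trans ?_
  rw [intervalIntegral.integral_of_le hy]
  exact setIntegral_le_integral (hu.integrable_deriv_sub hv) (ae_of_all _ fun _ => abs_nonneg _)

/-- If `U j → u` fast enough, then almost everywhere the first-order expansion of `U j` at `x` holds
on a neighbourhood of `x` that does not depend on `j`. The point `x` has to be a Lebesgue point of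
the tails of the series of the errors `|(U j)' - u'|`. -/
theorem ae_uniform_expansion {U : ℕ → ℝ → ℝ} (hU : ∀ j, IsACL1 (U j)) (hu : IsACL1 u)
    (hs : Summable fun j => ∫ x, |deriv (U j) x - deriv u x|) :
    ∀ᵐ x, ∀ η > 0, ∃ δ > 0, ∀ᶠ j in atTop, ∀ t ∈ Icc 0 δ,
      |U j (x + t) - U j x - deriv u x * t| ≤ η * t := by
  let F : ℕ → ℝ → ℝ := fun j x => |deriv (U j) x - deriv u x|
  let S : ℕ → ℝ → ℝ := fun J x => ∑' j, F (j + J) x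
  have hF : ∀ j, Integrable (F j) := fun j => (hU j).integrable_deriv_sub hu
  have hF0 : ∀ j x, 0 ≤ F j x := fun j x => abs_nonneg _
  have hS : ∀ J, Integrable (S J) := fun J =>
    (integrable_tsum_of_summable_integral (fun j => hF (j + J)) (fun j => hF0 (j + J))
      ((summable_nat_add_iff J).2 hs)).1
  have hsum := (integrable_tsum_of_summable_integral hF hF0 hs).2
  have hleb : ∀ᵐ x, ∀ J, ∀ c, HasDerivAt (fun y => ∫ t in c..y, S J t) (S J x) x :=
    ae_all_iff.2 fun J => LocallyIntegrable.ae_hasDerivAt_integral (hS J).locallyIntegrable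
  filter_upwards [hsum, hleb, hu.ae_differentiableAt] with x hx hxS hxu η hη
  have hη3 : 0 < η / 3 := by positivity
  obtain ⟨J, hJ⟩ : ∃ J, S J x < η / 3 :=
    ((tendsto_sum_nat_add fun j => F j x).eventually_lt_const hη3).exists
  -- Bounds for the increments of `u` and of the primitive of `S J` near `x`.
  have e1 := (hasDerivAt_iff_isLittleO.1 hxu.hasDerivAt).def hη3
  have e2 := (hasDerivAt_iff_isLittleO.1 (hxS J x)).def hη3
  obtain ⟨δ, hδ, hball⟩ := Metric.eventually_nhds_iff.1 (e1.and e2)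
  refine ⟨δ / 2, half_pos hδ, (eventually_ge_atTop J).mono fun j hj t ht => ?_⟩
  obtain ⟨b1, b2⟩ := hball (y := x + t) (by
    rw [Real.dist_eq, add_sub_cancel_left, abs_of_nonneg ht.1]; linarith [ht.2])
  simp only [add_sub_cancel_left, Real.norm_eq_abs, intervalIntegral.integral_same, sub_zero,
    smul_eq_mul, abs_of_nonneg ht.1] at b1 b2
  have hle : x ≤ x + t := by linarith [ht.1]
  have b3 := (hU j).abs_increment_sub_le hu hle
  have b4 : ∫ s in x..(x + t), |deriv (U j) s - deriv u s| ≤ ∫ s in x..(x + t), S J s := by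
    refine intervalIntegral.integral_mono_ae hle (hF j).intervalIntegrable
      (hS J).intervalIntegrable ?_
    filter_upwards [hsum] with s hs
    have := ((summable_nat_add_iff J).2 hs).le_tsum (j - J) fun i _ => hF0 (i + J) s
    simpa [Nat.sub_add_cancel hj] using this
  have b5 := (abs_le.1 b2).2
  have b6 : t * S J x ≤ t * (η / 3) := mul_le_mul_of_nonneg_left hJ.le ht.1
  have b7 : |U j (x + t) - U j x - deriv u x * t| ≤
      |(U j (x + t) - U j x) - (u (x + t) - u x)| + |u (x + t) - u x - t * deriv u x| := by
    refine (le_of_eq ?_).trans (abs_add_le _ _)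
    congr 1; ring
  linarith

end IsACL1

/-- Under a uniform first-order expansion, averages over `[x, x + h]` grow with half the slope of
the functions. -/
theorem tendsto_segAvg_slope {P : ℕ → ℝ → ℝ} (hP : ∀ j, Continuous (P j)) {x d : ℝ}
    (hexp : ∀ η > 0, ∃ δ > 0, ∀ᶠ j in atTop, ∀ t ∈ Icc 0 δ,
      |P j (x + t) - P j x - d * t| ≤ η * t)
    {l : Filter ℕ} (hl : l ≤ atTop) {h : ℕ → ℝ} (h0 : Tendsto h l (𝓝 0))
    (hpos : ∀ᶠ j in l, 0 < h j) :
    Tendsto (fun j => (segAvg (P j) x (h j) - P j x) / h j) l (𝓝 (d / 2)) := by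
  refine Metric.tendsto_nhds.2 fun η hη => ?_
  obtain ⟨δ, hδ, hev⟩ := hexp (η / 2) (half_pos hη)
  filter_upwards [hl hev, hpos, h0.eventually_le_const hδ] with j hj hj0 hjδ
  have hsub : segAvg (P j) x (h j) - P j x - d / 2 * h j =
      ∫ t in (0 : ℝ)..1, (P j (x + h j * t) - P j x - d * (h j * t)) := by
    have c1 : Continuous fun t => P j (x + h j * t) := (hP j).comp (by fun_prop)
    have c2 : Continuous fun t : ℝ => d * (h j * t) := by fun_prop
    have c3 : Continuous fun t => P j (x + h j * t) - P j x := c1.sub continuous_const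
    rw [intervalIntegral.integral_sub (c3.intervalIntegrable _ _)
      (c2.intervalIntegrable _ _), intervalIntegral.integral_sub (c1.intervalIntegrable _ _)
      intervalIntegrable_const]
    have hlin : ∫ t in (0 : ℝ)..1, d * (h j * t) = d * (h j * (1 / 2)) := by
      rw [intervalIntegral.integral_const_mul, intervalIntegral.integral_const_mul, integral_id]
      norm_num
    rw [hlin, intervalIntegral.integral_const, segAvg]
    simp only [sub_zero, one_smul]
    ring
  have hbd : |segAvg (P j) x (h j) - P j x - d / 2 * h j| ≤ η / 2 * h j := by
    rw [hsub]
    have := intervalIntegral.norm_integral_le_of_norm_le_const (a := (0 : ℝ)) (b := 1)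
      (f := fun t => P j (x + h j * t) - P j x - d * (h j * t)) (C := η / 2 * h j) fun t ht => ?_
    · simpa using this
    · rw [uIoc_of_le zero_le_one] at ht
      have h1 : h j * t ≤ h j := mul_le_of_le_one_right hj0.le ht.2
      refine (hj (h j * t) ⟨mul_nonneg hj0.le ht.1.le, h1.trans hjδ⟩).trans ?_
      exact mul_le_mul_of_nonneg_left h1 (half_pos hη).le
  rw [Real.dist_eq]
  have h2 : (segAvg (P j) x (h j) - P j x) / h j - d / 2 =
      (segAvg (P j) x (h j) - P j x - d / 2 * h j) / h j := by field_simp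
  rw [h2, abs_div, abs_of_pos hj0, div_lt_iff₀ hj0]
  exact hbd.trans_lt (mul_lt_mul_of_pos_right (half_lt_self hη) hj0)

namespace IsNonnegW11

variable {p : ℝ → ℝ} {x : ℝ} {P : ℕ → ℝ → ℝ}

/-- Pointwise convergence of the derivatives of the one-sided maximal functions. The lengths `h j`
of maximizing intervals converge in `[0, ∞]` along any ultrafilter, and the limit of the
derivatives is identified according to whether their limit is infinite, positive or zero. -/
theorem tendsto_deriv_rightMax_of_expansion (hP : ∀ j, IsNonnegW11 (P j)) (hp : IsNonnegW11 p)
    {ε : ℕ → ℝ} (hε : Tendsto ε atTop (𝓝 0)) (hPε : ∀ j x, |P j x - p x| ≤ ε j)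
    (hPg : ∀ j, DifferentiableAt ℝ (rightMax (P j)) x) (hPd : ∀ j, DifferentiableAt ℝ (P j) x)
    (hpg : DifferentiableAt ℝ (rightMax p) x) (hpd : DifferentiableAt ℝ p x)
    (hlim : Tendsto (fun j => deriv (P j) x) atTop (𝓝 (deriv p x)))
    (hexp : ∀ η > 0, ∃ δ > 0, ∀ᶠ j in atTop, ∀ t ∈ Icc 0 δ,
      |P j (x + t) - P j x - deriv p x * t| ≤ η * t) :
    Tendsto (fun j => deriv (rightMax (P j)) x) atTop (𝓝 (deriv (rightMax p) x)) := by
  rw [tendsto_iff_ultrafilter]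
  intro U hU
  choose h hh0 hhmax using fun j => (hP j).exists_segAvg_eq_rightMax x
  have hεU : Tendsto ε U (𝓝 0) := hε.mono_left hU
  have hPx : Tendsto (fun j => P j x) U (𝓝 (p x)) :=
    tendsto_iff_dist_tendsto_zero.2 (squeeze_zero (fun j => dist_nonneg) (fun j => hPε j x) hεU)
  have hgx : Tendsto (fun j => rightMax (P j) x) U (𝓝 (rightMax p x)) :=
    tendsto_iff_dist_tendsto_zero.2 (squeeze_zero (fun j => dist_nonneg)
      (fun j => (hP j).abs_rightMax_sub_le hp (hPε j) x) hεU)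
  have hform : ∀ j, 0 < h j →
      (rightMax (P j) x - P j x) / h j = deriv (rightMax (P j)) x := fun j hj =>
    ((hP j).deriv_rightMax_of_pos hj (hPg j) (hhmax j)).symm
  obtain ⟨L, hL⟩ : ∃ L : ℝ≥0∞, Tendsto (fun j => ENNReal.ofReal (h j)) U (𝓝 L) :=
    ⟨_, (U.map fun j => ENNReal.ofReal (h j)).le_nhds_lim⟩
  rcases eq_or_ne L ⊤ with rfl | hLtop
  · -- The intervals escape to infinity, so `rightMax p` vanishes at `x`.
    have hinf : Tendsto h U atTop := ENNReal.tendsto_ofReal_nhds_top.1 hL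
    have hzero : rightMax p x = 0 := by
      refine le_antisymm ?_ (hp.rightMax_nonneg x)
      have hup : Tendsto (fun j => (∫ t, p t) / h j + ε j) U (𝓝 0) := by
        simpa using (tendsto_const_nhds.div_atTop hinf).add hεU
      refine le_of_tendsto_of_tendsto hgx hup ?_
      filter_upwards [hinf.eventually_gt_atTop 0] with j hj
      have h1 := (abs_le.1 (abs_segAvg_sub_le (hP j).continuous hp.continuous (hPε j) x (h j))).2
      linarith [hp.segAvg_le_div x hj, hhmax j]
    have hmin : IsLocalMin (rightMax p) x :=
      Eventually.of_forall fun y => by rw [hzero]; exact hp.rightMax_nonneg y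
    rw [hmin.deriv_eq_zero]
    refine ((hgx.sub hPx).div_atTop hinf).congr' ?_
    filter_upwards [hinf.eventually_gt_atTop 0] with j hj using hform j hj
  have hreal : Tendsto h U (𝓝 L.toReal) := by
    refine ((ENNReal.tendsto_toReal hLtop).comp hL).congr fun j => ?_
    simp [hh0 j]
  set h₀ := L.toReal
  have hseg : segAvg p x h₀ = rightMax p x := by
    have h1 : Tendsto (fun j => segAvg p x (h j)) U (𝓝 (segAvg p x h₀)) :=
      (((continuous_segAvg hp.continuous).comp (Continuous.prodMk_right x)).tendsto h₀).comp hreal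
    have h2 : Tendsto (fun j => segAvg (P j) x (h j) - segAvg p x (h j)) U (𝓝 0) :=
      squeeze_zero_norm (fun j =>
        abs_segAvg_sub_le (hP j).continuous hp.continuous (hPε j) x (h j)) hεU
    refine tendsto_nhds_unique ?_ hgx
    refine ((h2.add h1).congr fun j => ?_).trans (by rw [zero_add])
    rw [sub_add_cancel, hhmax]
  rcases (ENNReal.toReal_nonneg : 0 ≤ h₀).eq_or_lt with hz | hpos
  · replace hz : h₀ = 0 := hz.symm
    rw [hz, segAvg_zero] at hseg
    rw [hz] at hreal
    rw [hp.deriv_rightMax_of_eq hpg hpd hseg]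
    rcases U.eventually_or.1 (Eventually.of_forall fun j => (hh0 j).eq_or_lt) with hev | hev
    · refine (hlim.mono_left hU).congr' ?_
      filter_upwards [hev] with j hj
      have := hhmax j
      rw [← hj, segAvg_zero] at this
      exact ((hP j).deriv_rightMax_of_eq (hPg j) (hPd j) this).symm
    · -- Shrinking nondegenerate intervals force the slope of `p` to vanish: it is nonnegative
      -- as the average over `[x, x + h j]` exceeds the value at `x`, and nonpositive as doubling
      -- the interval does not increase the average.
      have s1 := tendsto_segAvg_slope (fun j => (hP j).continuous) hexp hU hreal hev
      have s2 := tendsto_segAvg_slope (fun j => (hP j).continuous) hexp hU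
        (h := fun j => 2 * h j) (by simpa using hreal.const_mul 2)
        (hev.mono fun j hj => by linarith)
      have hge : 0 ≤ deriv p x / 2 := ge_of_tendsto s1 (hev.mono fun j hj => by
        refine div_nonneg ?_ hj.le
        rw [hhmax]; linarith [(hP j).le_rightMax x])
      have hle : 2 * (deriv p x / 2) ≤ deriv p x / 2 :=
        le_of_tendsto_of_tendsto (s2.const_mul 2) s1 (hev.mono fun j hj => by
          have h1 := (hP j).segAvg_le_rightMax x (h := 2 * h j) (by linarith)
          have h2 : 2 * ((segAvg (P j) x (2 * h j) - P j x) / (2 * h j)) =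
              (segAvg (P j) x (2 * h j) - P j x) / h j := by field_simp
          simp only
          rw [h2, hhmax]
          exact div_le_div_of_nonneg_right (by linarith) hj.le)
      have hd0 : deriv p x = 0 := by linarith
      rw [hd0, zero_div] at s1
      rw [hd0]
      refine s1.congr' ?_
      filter_upwards [hev] with j hj
      rw [hhmax, hform j hj]
  · rw [hp.deriv_rightMax_of_pos hpos hpg hseg]
    refine ((hgx.sub hPx).div hreal hpos.ne').congr' ?_
    filter_upwards [hreal.eventually_const_lt hpos] with j hj using hform j hj

theorem abs_sub_le_integral (hp : IsNonnegW11 p) {q : ℝ → ℝ} (hq : IsNonnegW11 q) (x : ℝ) :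
    |p x - q x| ≤ ∫ t, |deriv p t - deriv q t| :=
  hp.acl1.abs_sub_le_integral_of_tendsto hq.acl1 (hp.acl1.tendsto_atTop_zero hp.integrable)
    (hq.acl1.tendsto_atTop_zero hq.integrable) x

/-- Since all derivatives `(rightMax (P j))'` have integral zero, their `L¹` distance to
`(rightMax p)'` is twice the integral of the positive part of `(rightMax p)' - (rightMax (P j))'`,
which is dominated because `(rightMax (P j))' ≥ -|(P j)'|`. -/
theorem tendsto_deriv_rightMax_of_summable (hP : ∀ j, IsNonnegW11 (P j)) (hp : IsNonnegW11 p)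
    (hs : Summable fun j => ∫ x, |deriv (P j) x - deriv p x|) :
    Tendsto (fun j => ∫ x, |deriv (rightMax (P j)) x - deriv (rightMax p) x|) atTop (𝓝 0) := by
  obtain ⟨hSi, hSs⟩ := integrable_tsum_of_summable_integral
    (fun j => (hP j).acl1.integrable_deriv_sub hp.acl1) (fun j x => abs_nonneg _) hs
  have hpt : ∀ᵐ x, Tendsto (fun j => deriv (rightMax (P j)) x) atTop
      (𝓝 (deriv (rightMax p) x)) := by
    filter_upwards [ae_all_iff.2 fun j => (hP j).isACL1_rightMax.ae_differentiableAt,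
      ae_all_iff.2 fun j => (hP j).acl1.ae_differentiableAt,
      hp.isACL1_rightMax.ae_differentiableAt, hp.acl1.ae_differentiableAt, hSs,
      IsACL1.ae_uniform_expansion (fun j => (hP j).acl1) hp.acl1 hs] with x h1 h2 h3 h4 h5 h6
    exact tendsto_deriv_rightMax_of_expansion hP hp hs.tendsto_atTop_zero
      (fun j x => (hP j).abs_sub_le_integral hp x) h1 h2 h3 h4
      (tendsto_iff_dist_tendsto_zero.2 h5.tendsto_atTop_zero) h6
  have hpos : Tendsto (fun j => ∫ x, max (deriv (rightMax p) x - deriv (rightMax (P j)) x) 0)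
      atTop (𝓝 0) := by
    have := tendsto_integral_of_dominated_convergence (f := fun _ : ℝ => (0 : ℝ)) (μ := volume)
      (F := fun j x => max (deriv (rightMax p) x - deriv (rightMax (P j)) x) 0)
      (fun x => |deriv (rightMax p) x| + |deriv p x| + ∑' j, |deriv (P j) x - deriv p x|)
      (fun j => (((measurable_deriv _).sub (measurable_deriv _)).max
        measurable_const).aestronglyMeasurable)
      ((hp.isACL1_rightMax.integrable_deriv.norm.add hp.acl1.integrable_deriv.norm).add hSi)
      (fun j => ?_) ?_
    · simpa using this
    · filter_upwards [(hP j).neg_abs_deriv_le_deriv_rightMax, hSs] with x hx hsx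
      have h1 := hsx.le_tsum j fun i _ => abs_nonneg _
      rw [Real.norm_of_nonneg (le_max_right _ _)]
      have h2 := abs_sub_abs_le_abs_sub (deriv (P j) x) (deriv p x)
      refine max_le (by linarith [le_abs_self (deriv (rightMax p) x)]) ?_
      have := abs_nonneg (deriv (P j) x - deriv p x)
      positivity
    · filter_upwards [hpt] with x hx
      have := ((tendsto_const_nhds (x := deriv (rightMax p) x)).sub hx).max
        (tendsto_const_nhds (x := (0 : ℝ)))
      simpa using this
  have h2 := hpos.const_mul 2
  rw [mul_zero] at h2
  refine h2.congr fun j => ?_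
  have i1 := (hP j).isACL1_rightMax.integrable_deriv
  have i2 := hp.isACL1_rightMax.integrable_deriv
  have i3 : Integrable fun x => max (deriv (rightMax p) x - deriv (rightMax (P j)) x) 0 :=
    (i2.sub i1).pos_part
  have i4 : Integrable fun x => deriv (rightMax (P j)) x - deriv (rightMax p) x := i1.sub i2
  have hz : ∫ x, (deriv (rightMax (P j)) x - deriv (rightMax p) x) = 0 := by
    rw [integral_sub i1 i2, (hP j).integral_deriv_rightMax, hp.integral_deriv_rightMax, sub_zero]
  have hsplit : ∫ x, (2 * max (deriv (rightMax p) x - deriv (rightMax (P j)) x) 0 +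
      (deriv (rightMax (P j)) x - deriv (rightMax p) x)) =
      2 * ∫ x, max (deriv (rightMax p) x - deriv (rightMax (P j)) x) 0 := by
    rw [integral_add (i3.const_mul 2) i4, hz, add_zero, integral_const_mul]
  rw [← hsplit]
  refine integral_congr_ae (ae_of_all _ fun x => ?_)
  simp only
  rcases le_total (deriv (rightMax p) x) (deriv (rightMax (P j)) x) with h | h
  · rw [max_eq_right (by linarith), abs_of_nonneg (by linarith)]; ring
  · rw [max_eq_left (by linarith), abs_of_nonpos (by linarith)]; ring

theorem tendsto_deriv_rightMax (hP : ∀ j, IsNonnegW11 (P j)) (hp : IsNonnegW11 p)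
    (h : Tendsto (fun j => ∫ x, |deriv (P j) x - deriv p x|) atTop (𝓝 0)) :
    Tendsto (fun j => ∫ x, |deriv (rightMax (P j)) x - deriv (rightMax p) x|) atTop (𝓝 0) := by
  refine tendsto_of_subseq_tendsto fun ns hns => ?_
  have hsmall : ∀ n : ℕ, ∃ m, ∫ x, |deriv (P (ns m)) x - deriv p x| < (1 / 2 : ℝ) ^ n := fun n =>
    ((h.comp hns).eventually_lt_const (by positivity)).exists
  choose ms hms using hsmall
  refine ⟨ms, tendsto_deriv_rightMax_of_summable (fun j => hP (ns (ms j))) hp ?_⟩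
  exact Summable.of_nonneg_of_le (fun j => integral_nonneg fun x => abs_nonneg _)
    (fun j => (hms j).le) summable_geometric_two

end IsNonnegW11
/-! ### The uncentered maximal function as a maximum of one-sided ones -/

theorem segAvg_sub_left (p : ℝ → ℝ) (x k : ℝ) : segAvg p (x - k) k = segAvg p x (-k) := by
  have := intervalIntegral.integral_comp_sub_left (a := 0) (b := 1) (fun t => p (x + -k * t)) 1
  simp only [segAvg]
  rw [sub_zero, sub_self] at this
  rw [← this]
  congr 1; ext t; congr 1; ring

/-- The maximum of the one-sided maximal functions to the right and to the left. -/
noncomputable def twoSidedMax (p : ℝ → ℝ) (x : ℝ) : ℝ :=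
  max (rightMax p x) (rightMax (fun t => p (-t)) (-x))

namespace IsNonnegW11

variable {p : ℝ → ℝ} {x : ℝ}

theorem segAvg_le_twoSidedMax (hp : IsNonnegW11 p) (x h : ℝ) : segAvg p x h ≤ twoSidedMax p x := by
  rcases le_total 0 h with h0 | h0
  · exact (hp.segAvg_le_rightMax x h0).trans (le_max_left _ _)
  · have := hp.comp_neg.segAvg_le_rightMax (-x) (neg_nonneg.2 h0)
    rw [segAvg_comp_neg, neg_neg] at this
    exact this.trans (le_max_right _ _)

/-- An average over an interval containing `x` is a convex combination of the averages over the two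
parts into which `x` cuts the interval. -/
theorem segAvg_le_twoSidedMax_of_mem (hp : IsNonnegW11 p) {a h : ℝ} (h1 : a < x) (h2 : x < a + h) :
    segAvg p a h ≤ twoSidedMax p x := by
  have hh : 0 < h := by linarith
  have e1 := mul_segAvg p x (a - x)
  have e2 := mul_segAvg p x (a + h - x)
  have e3 := mul_segAvg p a h
  rw [add_sub_cancel, intervalIntegral.integral_symm] at e1
  rw [add_sub_cancel] at e2
  have e4 := intervalIntegral.integral_add_adjacent_intervals
    (hp.continuous.intervalIntegrable (μ := volume) a x) (hp.continuous.intervalIntegrable x (a + h))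
  have b1 := mul_le_mul_of_nonneg_left (hp.segAvg_le_twoSidedMax x (a - x))
    (show 0 ≤ x - a by linarith)
  have b2 := mul_le_mul_of_nonneg_left (hp.segAvg_le_twoSidedMax x (a + h - x))
    (show 0 ≤ a + h - x by linarith)
  refine le_of_mul_le_mul_left ?_ hh
  nlinarith

theorem setLAverage_ball (hp : IsNonnegW11 p) {f : ℝ → ℝ}
    (hf : ∀ᵐ y, ‖f y‖ₑ = ENNReal.ofReal (p y)) (c : ℝ) {r : ℝ} (hr : 0 < r) :
    ⨍⁻ y in Metric.ball c r, ‖f y‖ₑ ∂volume = ENNReal.ofReal (segAvg p (c - r) (2 * r)) := by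
  rw [setLAverage_eq, lintegral_congr_ae (ae_restrict_of_ae hf),
    ← ofReal_integral_eq_lintegral_ofReal hp.integrable.integrableOn (ae_of_all _ hp.nonneg),
    Real.volume_ball, ← ENNReal.ofReal_div_of_pos (by positivity), Real.ball_eq_Ioo,
    ← integral_Ioc_eq_integral_Ioo, ← intervalIntegral.integral_of_le (by linarith)]
  congr 1
  rw [div_eq_iff (by positivity), mul_comm, mul_segAvg]
  congr 1; ring

theorem uncenteredMaximal_eq (hp : IsNonnegW11 p) {f : ℝ → ℝ}
    (hf : ∀ᵐ y, ‖f y‖ₑ = ENNReal.ofReal (p y)) (x : ℝ) :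
    uncenteredMaximal f x = ENNReal.ofReal (twoSidedMax p x) := by
  refine le_antisymm (iSup_le fun c => iSup_le fun r => iSup_le fun hx => ?_) ?_
  · have hr : 0 < r := Metric.pos_of_mem_ball hx
    rw [hp.setLAverage_ball hf c hr]
    rw [Real.ball_eq_Ioo] at hx
    exact ENNReal.ofReal_le_ofReal
      (hp.segAvg_le_twoSidedMax_of_mem hx.1 (by linarith [hx.2]))
  -- A closed interval containing `x`, possibly degenerate, is a limit of open ones.
  · have key : ∀ a h, 0 ≤ h → a ≤ x → x ≤ a + h →
        ENNReal.ofReal (segAvg p a h) ≤ uncenteredMaximal f x := by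
      intro a h h0 h1 h2
      have hlim : Tendsto (fun η : ℝ => ENNReal.ofReal (segAvg p (a - η) (h + 2 * η))) (𝓝[>] 0)
          (𝓝 (ENNReal.ofReal (segAvg p a h))) := by
        have hc : Continuous fun η : ℝ => ENNReal.ofReal (segAvg p (a - η) (h + 2 * η)) :=
          ENNReal.continuous_ofReal.comp ((continuous_segAvg hp.continuous).comp
            (by fun_prop : Continuous fun η : ℝ => (a - η, h + 2 * η)))
        have := hc.tendsto 0
        simp only [sub_zero, mul_zero, add_zero] at this
        exact this.mono_left nhdsWithin_le_nhds
      refine le_of_tendsto hlim ?_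
      filter_upwards [self_mem_nhdsWithin] with η (hη : 0 < η)
      have h3 := hp.setLAverage_ball hf (a + h / 2) (r := h / 2 + η) (by linarith)
      rw [show a + h / 2 - (h / 2 + η) = a - η by ring,
        show 2 * (h / 2 + η) = h + 2 * η by ring] at h3
      rw [← h3]
      have hmem : x ∈ Metric.ball (a + h / 2) (h / 2 + η) := by
        rw [Real.ball_eq_Ioo]; constructor <;> linarith
      exact le_iSup_of_le (a + h / 2) (le_iSup_of_le (h / 2 + η) (le_iSup_of_le hmem le_rfl))
    obtain ⟨h, hh, hmax⟩ := hp.exists_segAvg_eq_rightMax x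
    obtain ⟨k, hk, kmax⟩ := hp.comp_neg.exists_segAvg_eq_rightMax (-x)
    rw [twoSidedMax, ENNReal.ofReal_max, ← hmax, ← kmax, segAvg_comp_neg, ← segAvg_sub_left]
    exact max_le (key x h hh le_rfl (by linarith)) (key (x - k) k hk (by linarith) (by linarith))

end IsNonnegW11

theorem integral_abs_deriv_comp_neg_sub (u v : ℝ → ℝ) :
    ∫ x, |deriv (fun y => u (-y)) x - deriv (fun y => v (-y)) x| =
      ∫ x, |deriv u x - deriv v x| := by
  rw [← integral_neg_eq_self fun x => |deriv u x - deriv v x|]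
  congr 1; ext x
  rw [deriv_comp_neg, deriv_comp_neg, ← abs_neg]
  congr 1; ring

namespace IsNonnegW11

variable {p : ℝ → ℝ} {P : ℕ → ℝ → ℝ}

theorem isACL1_twoSidedMax (hp : IsNonnegW11 p) : IsACL1 (twoSidedMax p) :=
  hp.isACL1_rightMax.max hp.comp_neg.isACL1_rightMax.comp_neg

theorem tendsto_rightMax (hP : ∀ j, IsNonnegW11 (P j)) (hp : IsNonnegW11 p)
    (h : Tendsto (fun j => ∫ x, |deriv (P j) x - deriv p x|) atTop (𝓝 0)) (x : ℝ) :
    Tendsto (fun j => rightMax (P j) x) atTop (𝓝 (rightMax p x)) :=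
  tendsto_iff_dist_tendsto_zero.2 (squeeze_zero (fun _ => dist_nonneg) (fun j =>
    (hP j).abs_rightMax_sub_le hp ((hP j).abs_sub_le_integral hp) x) h)

theorem tendsto_deriv_twoSidedMax (hP : ∀ j, IsNonnegW11 (P j)) (hp : IsNonnegW11 p)
    (h : Tendsto (fun j => ∫ x, |deriv (P j) x - deriv p x|) atTop (𝓝 0)) :
    Tendsto (fun j => ∫ x, |deriv (twoSidedMax (P j)) x - deriv (twoSidedMax p) x|)
      atTop (𝓝 0) := by
  have hneg : Tendsto (fun j => ∫ x, |deriv (fun t => P j (-t)) x - deriv (fun t => p (-t)) x|)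
      atTop (𝓝 0) := by
    simpa only [integral_abs_deriv_comp_neg_sub] using h
  refine IsACL1.tendsto_deriv_max (fun j => (hP j).isACL1_rightMax)
    (fun j => (hP j).comp_neg.isACL1_rightMax.comp_neg) hp.isACL1_rightMax
    hp.comp_neg.isACL1_rightMax.comp_neg (fun x => tendsto_rightMax hP hp h x)
    (fun x => tendsto_rightMax (fun j => (hP j).comp_neg) hp.comp_neg hneg (-x))
    (tendsto_deriv_rightMax hP hp h) ?_
  simp only [integral_abs_deriv_comp_neg_sub (rightMax _)]
  exact tendsto_deriv_rightMax (fun j => (hP j).comp_neg) hp.comp_neg hneg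

end IsNonnegW11

/-! ### Continuity on `W^{1,1}` -/

namespace SobolevW11

/-- The absolutely continuous representative of an element of `W^{1,1}(ℝ)`. -/
noncomputable def rep (f : SobolevW11) (x : ℝ) : ℝ := ∫ t in Iic x, weakDeriv f t

/-- The absolute value of the absolutely continuous representative. -/
noncomputable def absRep (f : SobolevW11) (x : ℝ) : ℝ := max (rep f x) (-rep f x)

theorem isACL1_rep (f : SobolevW11) : IsACL1 (rep f) :=
  (isACL1_integral_Iic (L1.integrable_coeFn _)).1

theorem deriv_rep (f : SobolevW11) : deriv (rep f) =ᵐ[volume] weakDeriv f :=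
  (isACL1_integral_Iic (L1.integrable_coeFn _)).2

theorem toL1_ae_eq_rep (f : SobolevW11) : toL1 f =ᵐ[volume] rep f :=
  HasWeakDeriv.ae_eq_integral_Iic f.2 (L1.integrable_coeFn _) (L1.integrable_coeFn _)

theorem integrable_rep (f : SobolevW11) : Integrable (rep f) :=
  (L1.integrable_coeFn _).congr (toL1_ae_eq_rep f)

theorem isNonnegW11_absRep (f : SobolevW11) : IsNonnegW11 (absRep f) where
  acl1 := (isACL1_rep f).max (isACL1_rep f).neg
  integrable := (integrable_rep f).abs
  nonneg _ := abs_nonneg _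

theorem enorm_toL1 (f : SobolevW11) : ∀ᵐ y, ‖toL1 f y‖ₑ = ENNReal.ofReal (absRep f y) := by
  filter_upwards [toL1_ae_eq_rep f] with y hy
  rw [hy, Real.enorm_eq_ofReal_abs]
  rfl

theorem uncenteredMaximal_toL1 (f : SobolevW11) (x : ℝ) :
    uncenteredMaximal (toL1 f) x = ENNReal.ofReal (twoSidedMax (absRep f) x) :=
  (isNonnegW11_absRep f).uncenteredMaximal_eq (enorm_toL1 f) x

theorem integral_abs_deriv_rep_sub_le (f g : SobolevW11) :
    ∫ x, |deriv (rep f) x - deriv (rep g) x| ≤ ‖f - g‖ := by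
  have h1 : ∫ x, |deriv (rep f) x - deriv (rep g) x| = ‖weakDeriv (f - g)‖ := by
    rw [L1.norm_eq_integral_norm]
    refine integral_congr_ae ?_
    filter_upwards [deriv_rep f, deriv_rep g, Lp.coeFn_sub (weakDeriv f) (weakDeriv g)]
      with x hf hg hfg
    have : weakDeriv (f - g) x = weakDeriv f x - weakDeriv g x := hfg
    rw [this, hf, hg, Real.norm_eq_abs]
  rw [h1, norm_eq]
  linarith [norm_nonneg (toL1 (f - g))]

theorem tendsto_deriv_absRep {F : ℕ → SobolevW11} {f : SobolevW11}
    (h : Tendsto F atTop (𝓝 f)) :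
    Tendsto (fun j => ∫ x, |deriv (absRep (F j)) x - deriv (absRep f) x|) atTop (𝓝 0) := by
  have h1 : Tendsto (fun j => ∫ x, |deriv (rep (F j)) x - deriv (rep f) x|) atTop (𝓝 0) :=
    squeeze_zero (fun j => integral_nonneg fun x => abs_nonneg _)
      (fun j => integral_abs_deriv_rep_sub_le (F j) f) (tendsto_iff_norm_sub_tendsto_zero.1 h)
  have h2 : ∀ x, Tendsto (fun j => rep (F j) x) atTop (𝓝 (rep f x)) := fun x =>
    tendsto_iff_dist_tendsto_zero.2 (squeeze_zero (fun j => dist_nonneg) (fun j =>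
      (isACL1_rep (F j)).abs_sub_le_integral_of_tendsto (isACL1_rep f)
        ((isACL1_rep (F j)).tendsto_atTop_zero (integrable_rep (F j)))
        ((isACL1_rep f).tendsto_atTop_zero (integrable_rep f)) x) h1)
  refine IsACL1.tendsto_deriv_max (fun j => (isACL1_rep (F j))) (fun j => (isACL1_rep (F j)).neg)
    (isACL1_rep f) (isACL1_rep f).neg h2 (fun x => (h2 x).neg) h1 ?_
  have h3 : ∀ u v : ℝ → ℝ, ∀ x, |deriv (fun y => -u y) x - deriv (fun y => -v y) x| =
      |deriv u x - deriv v x| := fun u v x => by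
    rw [deriv.fun_neg, deriv.fun_neg, ← abs_neg]; congr 1; ring
  simpa only [h3] using h1

end SobolevW11
end

theorem theorem1 :
    (∀ (f : SobolevW11) (x : ℝ), uncenteredMaximal (SobolevW11.toL1 f) x < ⊤) ∧
    ∃ D : SobolevW11 → Lp ℝ 1 (volume : Measure ℝ),
      (∀ f : SobolevW11, HasWeakDeriv (fun x => (uncenteredMaximal (SobolevW11.toL1 f) x).toReal) (D f)) ∧
      Continuous D := by
  have hM : ∀ f : SobolevW11, IsACL1 (twoSidedMax (SobolevW11.absRep f)) := fun f =>
    (SobolevW11.isNonnegW11_absRep f).isACL1_twoSidedMax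
  refine ⟨fun f x => by rw [SobolevW11.uncenteredMaximal_toL1]; exact ENNReal.ofReal_lt_top,
    fun f => (hM f).integrable_deriv.toL1 _, fun f => ?_, ?_⟩
  · refine (hM f).hasWeakDeriv.congr_ae (ae_of_all _ fun x => ?_)
      (Integrable.coeFn_toL1 (hM f).integrable_deriv).symm
    have h0 : 0 ≤ twoSidedMax (SobolevW11.absRep f) x :=
      ((SobolevW11.isNonnegW11_absRep f).rightMax_nonneg x).trans (le_max_left _ _)
    simp only [SobolevW11.uncenteredMaximal_toL1, ENNReal.toReal_ofReal h0]
  · refine continuous_iff_seqContinuous.2 fun F f hF => ?_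
    refine tendsto_iff_norm_sub_tendsto_zero.2 ((IsNonnegW11.tendsto_deriv_twoSidedMax
      (fun j => (SobolevW11.isNonnegW11_absRep (F j))) (SobolevW11.isNonnegW11_absRep f)
      (SobolevW11.tendsto_deriv_absRep hF)).congr fun j => ?_)
    rw [Function.comp_apply, ← Integrable.toL1_sub, L1.norm_of_fun_eq_integral_norm]
    rfl
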